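/- Let $k\ge 0$ and let $(\Lambda,d)$ be a $k$-graph, that is, a countable small category $\Lambda$ with a functor $d:\Lambda\to\mathbb N^k$ such that whenever $d(\lambda)=m+n$ there are unique $\mu,\sigma\in\Lambda$ with $d(\mu)=m$, $d(\sigma)=n$ and $\lambda=\mu\sigma$. Morphisms of $\Lambda$ are called paths and its objects vertices; $r$ and $s$ are the codomain and domain maps, and a vertex $v$ is identified with its identity morphism, so that the set of vertices is $\Lambda^0=d^{-1}(0)$. For $\lambda,\mu\in\Lambda$ put $$\Lambda^{\min}(\lambda,\mu)=\{(\alpha,\beta):\lambda\alpha=\mu\beta,\ d(\lambda\alpha)=d(\lambda)\vee d(\mu)\},$$ and assume that $\Lambda$ is finitely aligned: $\Lambda^{\min}(\lambda,\mu)$ is finite for all $\lambda,\mu\in\Lambda$. A set $E$ of paths with range $v$ is exhaustive if for every path $\mu$ with range $v$ there is $\lambda\in E$ with $\Lambda^{\min}(\lambda,\mu)\ne\emptyset$. A Cuntz–Krieger $\Lambda$-family is a family $\{t_\lambda:\lambda\in\Lambda\}$ of partial isometries in a $C^*$-algebra such that (i) the $t_v$, $v\in\Lambda^0$, are mutually orthogonal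 projections; (ii) $t_\lambda t_\mu=t_{\lambda\mu}$ whenever $s(\lambda)=r(\mu)$; (iii) $t_\lambda^*t_\mu=\sum_{(\alpha,\beta)\in\Lambda^{\min}(\lambda,\mu)}t_\alpha t_\beta^*$ for all $\lambda,\mu\in\Lambda$; (iv) $\prod_{\lambda\in E}(t_v-t_\lambda t_\lambda^*)=0$ for every $v\in\Lambda^0$ and every finite exhaustive set $E$ of paths with range $v$. Let $C^*(\Lambda)$ be the universal $C^*$-algebra generated by a Cuntz–Krieger $\Lambda$-family $\{s_\lambda:\lambda\in\Lambda\}$, and let $\gamma:\mathbb T^k\to\operatorname{Aut}(C^*(\Lambda))$ be the gauge action, determined by $\gamma_z(s_\lambda)=z^{d(\lambda)}s_\lambda$, where $z^m=z_1^{m_1}\cdots z_k^{m_k}$. Let $\pi$ be a ($*$-)homomorphism of $C^*(\Lambda)$ into a $C^*$-algebra. Suppose that there is a strongly continuous action $\theta:\mathbb T^k\to\operatorname{Aut}\big(C^*(\{\pi(s_\lambda):\lambda\in\Lambda\})\big)$ such that $\theta_z\circ\pi=\pi\circ\gamma_z$ for all $z\in\mathbb T^k$, and that $\pi(s_v)\ne0$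 for all $v\in\Lambda^0$. Then $\pi$ is injective. -/

import Mathlib

open CategoryTheory
open scoped ENNReal CStarAlgebra

universe u w

noncomputable section

/-- A `k`-graph: a countable small category together with a degree functor to the monoid `ℕ ^ k`
having the factorisation property. A morphism `f : v ⟶ w` is a path with source `v` and range `w`;
the path usually written `λ μ` (first `μ`, then `λ`) is the Mathlib composite `μ ≫ λ`. -/
structure KGraph (k : ℕ) where
  /-- the objects (vertices) -/
  Vertex : Type u
  [category : SmallCategory Vertex]
  [countable_vertex : Countable Vertex]
  [countable_hom : ∀ v w : Vertex, Countable (v ⟶ w)]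
  /-- the degree functor -/
  deg : ∀ ⦃v w : Vertex⦄, (v ⟶ w) → (Fin k → ℕ)
  deg_id : ∀ v : Vertex, deg (𝟙 v) = 0
  deg_comp : ∀ ⦃u v w : Vertex⦄ (g : u ⟶ v) (f : v ⟶ w), deg (g ≫ f) = deg f + deg g
  /-- the factorisation property: if `d(f) = m + n`, then there are unique `p`, `q` with
  `d(p) = m`, `d(q) = n` and `f = p q` -/
  factorisation : ∀ ⦃v w : Vertex⦄ (f : v ⟶ w) (m n : Fin k → ℕ), deg f = m + n →
    ∃! x : (Σ u : Vertex, (u ⟶ w) × (v ⟶ u)),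
      deg x.2.1 = m ∧ deg x.2.2 = n ∧ x.2.2 ≫ x.2.1 = f

namespace KGraph

attribute [instance] KGraph.category KGraph.countable_vertex KGraph.countable_hom

variable {k : ℕ} (Λ : KGraph.{u} k)

/-- The set of pairs `(α, β)` giving minimal common extensions of the paths `f` and `g`:
`f α = g β` and `d(f α) = d(f) ∨ d(g)`. Only paths with a common range can have any, and two such
`α`, `β` have a common source, which is recorded as the first component. -/
def Lmin {Λ : KGraph.{u} k} {a b w : Λ.Vertex} (f : a ⟶ w) (g : b ⟶ w) :
    Set (Σ u : Λ.Vertex, (u ⟶ a) × (u ⟶ b)) :=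
  {p | p.2.1 ≫ f = p.2.2 ≫ g ∧ Λ.deg (p.2.1 ≫ f) = Λ.deg f ⊔ Λ.deg g}

/-- `Λ` is finitely aligned: any two paths have only finitely many minimal common extensions. -/
class FinitelyAligned : Prop where
  finite_Lmin : ∀ ⦃a b w : Λ.Vertex⦄ (f : a ⟶ w) (g : b ⟶ w), (Lmin f g).Finite

/-- A set `E` of paths with range `v` is exhaustive if every path with range `v` has a common
extension with a member of `E`. -/
def Exhaustive {Λ : KGraph.{u} k} {v : Λ.Vertex} (E : Set (Σ a : Λ.Vertex, a ⟶ v)) : Prop :=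
  ∀ ⦃b : Λ.Vertex⦄ (g : b ⟶ v), ∃ e ∈ E, (Lmin e.2 g).Nonempty

/-- The product of `t_v - t_f t_f^*` over the list `l` of paths `f` with range `v`, in the order
of the list. The final factor `t_v` makes sense of the product in an algebra without unit. For a
family with the first two Cuntz-Krieger relations `t_v` is a unit for each of the
other factors, so that it does not change the product of a nonempty list (and an exhaustive set
is never empty). -/
def gapProd {Λ : KGraph.{u} k} {A : Type*} [NonUnitalCStarAlgebra A]
    (t : ∀ ⦃v w : Λ.Vertex⦄, (v ⟶ w) → A) {v : Λ.Vertex} (l : List (Σ a : Λ.Vertex, a ⟶ v)) : A :=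
  (l.map fun f => t (𝟙 v) - t f.2 * star (t f.2)).foldr (fun x y => x * y) (t (𝟙 v))

/-- Cuntz-Krieger `Λ`-families in a `C^*`-algebra. -/
structure IsCuntzKriegerFamily [Λ.FinitelyAligned] {A : Type*} [NonUnitalCStarAlgebra A]
    (t : ∀ ⦃v w : Λ.Vertex⦄, (v ⟶ w) → A) : Prop where
  /-- every `t_f` is a partial isometry -/
  partialIsometry : ∀ ⦃v w : Λ.Vertex⦄ (f : v ⟶ w), t f * star (t f) * t f = t f
  /-- relation (i): vertices give mutually orthogonal projections -/
  isStarProjection : ∀ v : Λ.Vertex, IsStarProjection (t (𝟙 v))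
  orthogonal : ∀ ⦃v w : Λ.Vertex⦄, v ≠ w → t (𝟙 v) * t (𝟙 w) = 0
  /-- relation (ii) -/
  comp : ∀ ⦃u v w : Λ.Vertex⦄ (g : u ⟶ v) (f : v ⟶ w), t f * t g = t (g ≫ f)
  /-- relation (iii) for two paths with the same range -/
  adjoint_mul : ∀ ⦃a b w : Λ.Vertex⦄ (f : a ⟶ w) (g : b ⟶ w),
    star (t f) * t g =
      ∑ p ∈ (FinitelyAligned.finite_Lmin f g).toFinset, t p.2.1 * star (t p.2.2)
  /-- relation (iii) for two paths with different ranges, where the sum is empty -/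
  adjoint_mul_of_ne : ∀ ⦃a b v w : Λ.Vertex⦄ (f : a ⟶ v) (g : b ⟶ w), v ≠ w → star (t f) * t g = 0
  /-- relation (iv), for every enumeration of a finite exhaustive set -/
  gapProd_eq_zero : ∀ ⦃v : Λ.Vertex⦄ (l : List (Σ a : Λ.Vertex, a ⟶ v)), l.Nodup →
    Exhaustive {f | f ∈ l} → gapProd t l = 0

section transport

variable {Λ} {A B : Type*} [NonUnitalCStarAlgebra A] [NonUnitalCStarAlgebra B]

lemma map_gapProd (φ : A →⋆ₙₐ[ℂ] B) (t : ∀ ⦃v w : Λ.Vertex⦄, (v ⟶ w) → A) {v : Λ.Vertex}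
    (l : List (Σ a : Λ.Vertex, a ⟶ v)) :
    φ (gapProd t l) = gapProd (fun _ _ f => φ (t f)) l := by
  induction l with
  | nil => simp [gapProd]
  | cons a l ih =>
    simp only [gapProd, List.map_cons, List.foldr_cons, map_mul, map_sub, map_star] at ih ⊢
    rw [ih]

lemma IsCuntzKriegerFamily.map [Λ.FinitelyAligned] {t : ∀ ⦃v w : Λ.Vertex⦄, (v ⟶ w) → A}
    (ht : Λ.IsCuntzKriegerFamily t) (φ : A →⋆ₙₐ[ℂ] B) :
    Λ.IsCuntzKriegerFamily (fun _ _ f => φ (t f)) where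
  partialIsometry v w f := by rw [← map_star, ← map_mul, ← map_mul, ht.partialIsometry]
  isStarProjection v := (ht.isStarProjection v).map φ
  orthogonal v w h := by rw [← map_mul, ht.orthogonal h, map_zero]
  comp u v w g f := by rw [← map_mul, ht.comp]
  adjoint_mul a b w f g := by simp only [← map_star, ← map_mul, ht.adjoint_mul, map_sum]
  adjoint_mul_of_ne a b v w f g h := by rw [← map_star, ← map_mul, ht.adjoint_mul_of_ne f g h, map_zero]
  gapProd_eq_zero v l hl hE := by rw [← map_gapProd, ht.gapProd_eq_zero l hl hE, map_zero]

lemma IsCuntzKriegerFamily.of_jointly_injective [Λ.FinitelyAligned]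
    {t : ∀ ⦃v w : Λ.Vertex⦄, (v ⟶ w) → A}
    {ι : Type*} {C : ι → Type*} [∀ i, NonUnitalCStarAlgebra (C i)] (φ : ∀ i, A →⋆ₙₐ[ℂ] C i)
    (hφ : ∀ a b : A, (∀ i, φ i a = φ i b) → a = b)
    (ht : ∀ i, Λ.IsCuntzKriegerFamily (fun _ _ f => φ i (t f))) :
    Λ.IsCuntzKriegerFamily t where
  partialIsometry v w f := hφ _ _ fun i => by
    simpa only [map_mul, map_star] using (ht i).partialIsometry f
  isStarProjection v :=
    ⟨hφ _ _ fun i => by simpa only [map_mul] using ((ht i).isStarProjection v).isIdempotentElem.eq,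
      hφ _ _ fun i => by
        simpa only [map_star] using ((ht i).isStarProjection v).isSelfAdjoint.star_eq⟩
  orthogonal v w h := hφ _ _ fun i => by simpa only [map_mul, map_zero] using (ht i).orthogonal h
  comp u v w g f := hφ _ _ fun i => by simpa only [map_mul] using (ht i).comp g f
  adjoint_mul a b w f g := hφ _ _ fun i => by
    simpa only [map_mul, map_star, map_sum] using (ht i).adjoint_mul f g
  adjoint_mul_of_ne a b v w f g h := hφ _ _ fun i => by
    simpa only [map_mul, map_star, map_zero] using (ht i).adjoint_mul_of_ne f g h
  gapProd_eq_zero v l hl hE := hφ _ _ fun i => by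
    simpa only [map_gapProd, map_zero] using (ht i).gapProd_eq_zero l hl hE

lemma IsCuntzKriegerFamily.norm_le_one [Λ.FinitelyAligned]
    {t : ∀ ⦃v w : Λ.Vertex⦄, (v ⟶ w) → A}
    (ht : Λ.IsCuntzKriegerFamily t) {v w : Λ.Vertex} (f : v ⟶ w) : ‖t f‖ ≤ 1 := by
  have h1 := ht.partialIsometry f
  have h2 : ‖star (t f) * t f‖ * ‖star (t f) * t f‖ ≤ ‖star (t f) * t f‖ := by
    rw [← CStarRing.norm_star_mul_self (x := star (t f) * t f)]
    apply le_of_eq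
    congr 1
    rw [star_mul, star_star, mul_assoc, ← mul_assoc (t f), h1]
  rw [CStarRing.norm_star_mul_self] at h2
  by_contra! hlt
  have h3 : 1 < ‖t f‖ * ‖t f‖ := one_lt_mul_of_lt_of_le hlt hlt.le
  nlinarith [mul_pos (zero_lt_one.trans h3) (sub_pos.2 h3)]

end transport

/-- The `C^*`-subalgebra of `B` generated by the set `S`. -/
def generatedCStar {B : Type*} [NonUnitalCStarAlgebra B] (S : Set B) :
    NonUnitalStarSubalgebra ℂ B :=
  (NonUnitalStarAlgebra.adjoin ℂ S).topologicalClosure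

/-- The members of a family indexed by the paths of `Λ`, as a set. -/
def familyRange {Λ : KGraph.{u} k} {B : Type*} (t : ∀ ⦃v w : Λ.Vertex⦄, (v ⟶ w) → B) : Set B :=
  Set.range fun p : (Σ v w : Λ.Vertex, v ⟶ w) => t p.2.2

section generated

variable {B : Type*} [NonUnitalCStarAlgebra B]

lemma isClosed_generatedCStar (S : Set B) : IsClosed (generatedCStar S : Set B) :=
  NonUnitalStarSubalgebra.isClosed_topologicalClosure _

instance (S : Set B) : NonUnitalCStarAlgebra (generatedCStar S) :=
  NonUnitalStarSubalgebra.nonUnitalCStarAlgebra (generatedCStar S)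
    (h_closed := isClosed_generatedCStar S)

lemma subset_generatedCStar (S : Set B) : S ⊆ generatedCStar S := fun _ hx =>
  NonUnitalStarSubalgebra.le_topologicalClosure _ (NonUnitalStarAlgebra.subset_adjoin ℂ S hx)

lemma generatedCStar_le {S : Set B} {C : NonUnitalStarSubalgebra ℂ B} (hC : IsClosed (C : Set B))
    (h : S ⊆ C) : generatedCStar S ≤ C :=
  NonUnitalStarSubalgebra.topologicalClosure_minimal _ (NonUnitalStarAlgebra.adjoin_le h) hC

lemma isSeparable_generatedCStar {S : Set B} (hS : S.Countable) :
    TopologicalSpace.IsSeparable (generatedCStar S : Set B) := by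
  have h1 : (S ∪ star S).Countable := by
    refine hS.union ?_
    rw [← Set.image_star]
    exact hS.image _
  have h2 : ((Subsemigroup.closure (S ∪ star S) : Subsemigroup B) : Set B).Countable := by
    have : Countable (S ∪ star S : Set B) := h1
    let F : FreeSemigroup (S ∪ star S : Set B) →ₙ* B := FreeSemigroup.lift Subtype.val
    have hc : Countable (FreeSemigroup (S ∪ star S : Set B)) :=
      Function.Injective.countable
        (f := fun x : FreeSemigroup (S ∪ star S : Set B) => (x.head, x.tail))
        fun x y h => by
          rw [Prod.mk.injEq] at h
          exact FreeSemigroup.ext h.1 h.2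
    have hle : Subsemigroup.closure (S ∪ star S) ≤ F.srange :=
      Subsemigroup.closure_le.2 fun x hx => ⟨FreeSemigroup.of ⟨x, hx⟩, by simp [F]⟩
    exact (Set.countable_range F).mono fun x hx => hle hx
  have h3 := (h2.isSeparable).span (R := ℂ)
  rw [← NonUnitalStarAlgebra.adjoin_eq_span] at h3
  exact h3.closure

/-- A `C^*`-algebra generated by a countable set has a copy in the lowest universe. -/
lemma small_generatedCStar {S : Set B} (hS : S.Countable) : Small.{0} (generatedCStar S) := by
  have : TopologicalSpace.SeparableSpace (generatedCStar S) :=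
    (isSeparable_generatedCStar hS).separableSpace
  let d := TopologicalSpace.denseSeq (generatedCStar S)
  refine small_of_injective (β := ℕ → ℝ) (f := fun x n => dist x (d n)) fun x y h => ?_
  have hd : DenseRange d := TopologicalSpace.denseRange_denseSeq _
  have h0 : (fun z => dist x z) = fun z => dist y z :=
    hd.equalizer (by fun_prop) (by fun_prop) h
  have h1 := congrFun h0 y
  simpa using h1

lemma exists_copy (B : Type*) [NonUnitalCStarAlgebra B] [Small.{0} B] :
    ∃ (A : Type) (_ : NonUnitalCStarAlgebra A) (f : A →⋆ₙₐ[ℂ] B) (g : B →⋆ₙₐ[ℂ] A),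
      ∀ b, f (g b) = b := by
  obtain ⟨A, ⟨e'⟩⟩ := ‹Small.{0} B›.equiv_small
  let e : A ≃ B := e'.symm
  let i1 : NonUnitalRing A := e.nonUnitalRing
  let i2 : Module ℂ A := e.module ℂ
  have hadd (a b : A) : e (a + b) = e a + e b := e.apply_symm_apply _
  have hmul (a b : A) : e (a * b) = e a * e b := e.apply_symm_apply _
  have hsmul (c : ℂ) (a : A) : e (c • a) = c • e a := e.apply_symm_apply _
  have hzero : e (0 : A) = 0 := e.apply_symm_apply _
  let i3 : StarRing A :=
    { star := fun a => e.symm (star (e a))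
      star_involutive := fun a => e.injective (by simp)
      star_mul := fun a b => e.injective (by
        change e (e.symm (star (e (a * b)))) = e (e.symm (star (e b)) * e.symm (star (e a)))
        simp [hmul])
      star_add := fun a b => e.injective (by
        change e (e.symm (star (e (a + b)))) = e (e.symm (star (e a)) + e.symm (star (e b)))
        simp [hadd]) }
  have hstar (a : A) : e (star a) = star (e a) := e.apply_symm_apply _
  let φ : A →ₙ+* B :=
    { toFun := e, map_mul' := hmul, map_zero' := hzero, map_add' := hadd }
  let ψ : A →ₗ[ℂ] B := { toFun := e, map_add' := hadd, map_smul' := hsmul }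
  let i4 : NonUnitalNormedRing A := NonUnitalNormedRing.induced A B φ e.injective
  let i5 : NormedSpace ℂ A := NormedSpace.induced ℂ A B ψ
  have hiso : Isometry e := AddMonoidHomClass.isometry_of_norm φ fun _ => rfl
  let i6 : NonUnitalCStarAlgebra A :=
    { i4, i3, i5 with
      complete := ((IsometryEquiv.mk e hiso).completeSpace_iff.2 inferInstance).complete
      norm_mul_self_le := fun a => by
        change ‖e a‖ * ‖e a‖ ≤ ‖e (star a * a)‖
        rw [hmul, hstar, CStarRing.norm_star_mul_self]
      smul_assoc := fun c a b => e.injective (by simp [hmul, hsmul, smul_mul_assoc])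
      smul_comm := fun c a b => e.injective (by simp [hmul, hsmul, mul_smul_comm])
      star_smul := fun c a => e.injective (by simp [hstar, hsmul]) }
  let f : A →⋆ₙₐ[ℂ] B :=
    { toFun := e, map_smul' := hsmul, map_zero' := hzero, map_add' := hadd, map_mul' := hmul,
      map_star' := hstar }
  let g : B →⋆ₙₐ[ℂ] A :=
    { toFun := e.symm
      map_smul' := fun c b => e.injective (by simp [hsmul])
      map_zero' := e.injective (by simp [hzero])
      map_add' := fun b c => e.injective (by simp [hadd])
      map_mul' := fun b c => e.injective (by simp [hmul])
      map_star' := fun b => e.injective (by simp [hstar]) }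
  exact ⟨A, i6, f, g, fun b => e.apply_symm_apply b⟩

end generated

variable [Λ.FinitelyAligned]

/-- A Cuntz-Krieger `Λ`-family in some `C^*`-algebra (in the lowest universe). -/
structure Rep where
  alg : Type
  [inst : NonUnitalCStarAlgebra alg]
  fam : ∀ ⦃v w : Λ.Vertex⦄, (v ⟶ w) → alg
  isFamily : Λ.IsCuntzKriegerFamily fam

attribute [instance] Rep.inst

/-- The `C^*`-algebra of bounded elements of the product over all Cuntz-Krieger `Λ`-families. -/
abbrev RepProd : Type (max 1 u) := lp (fun i : Λ.Rep => i.alg) ∞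

/-- The family `f ↦ (t_f)_t`, where `t` runs over all Cuntz-Krieger `Λ`-families. -/
def prodFamily ⦃v w : Λ.Vertex⦄ (f : v ⟶ w) : Λ.RepProd :=
  ⟨fun i => i.fam f, memℓp_infty ⟨1, by
    rintro _ ⟨i, rfl⟩
    exact i.isFamily.norm_le_one f⟩⟩

/-- The `C^*`-algebra `C^*(Λ)` of a finitely aligned `k`-graph, the universal `C^*`-algebra
generated by a Cuntz-Krieger `Λ`-family. It is built inside the product of all Cuntz-Krieger
families; its universal property, for `C^*`-algebras in every universe, is
`isCuntzKriegerFamily_s` with `existsUnique_lift`. -/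
def CStar : Type (max 1 u) := generatedCStar (familyRange Λ.prodFamily)

instance : NonUnitalCStarAlgebra Λ.CStar :=
  inferInstanceAs (NonUnitalCStarAlgebra (generatedCStar (familyRange Λ.prodFamily)))

/-- The inclusion of `C^*(Λ)` in the product of all Cuntz-Krieger families. -/
def incl : Λ.CStar →⋆ₙₐ[ℂ] Λ.RepProd :=
  NonUnitalStarSubalgebraClass.subtype (generatedCStar (familyRange Λ.prodFamily))

/-- The generating Cuntz-Krieger family `s` of `C^*(Λ)`. -/
def s ⦃v w : Λ.Vertex⦄ (f : v ⟶ w) : Λ.CStar :=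
  ⟨Λ.prodFamily f, subset_generatedCStar _ ⟨⟨v, w, f⟩, rfl⟩⟩

/-- The coordinate of `C^*(Λ)` at a Cuntz-Krieger family. -/
def coord (i : Λ.Rep) : Λ.CStar →⋆ₙₐ[ℂ] i.alg where
  toFun a := Λ.incl a i
  map_smul' _ _ := rfl
  map_zero' := rfl
  map_add' _ _ := rfl
  map_mul' _ _ := rfl
  map_star' _ := rfl

theorem isCuntzKriegerFamily_s : Λ.IsCuntzKriegerFamily Λ.s :=
  .of_jointly_injective Λ.coord
    (fun _ _ h => Subtype.ext (lp.ext (funext h))) fun i => i.isFamily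

/-- `C^*(Λ)` is generated by `s`. -/
theorem generatedCStar_s : generatedCStar (familyRange Λ.s) = ⊤ := by
  let D : NonUnitalStarSubalgebra ℂ Λ.RepProd := generatedCStar (familyRange Λ.prodFamily)
  let C := (generatedCStar (familyRange Λ.s)).map Λ.incl
  have hiso : Isometry Λ.incl := isometry_subtype_coe
  have hC : IsClosed (C : Set Λ.RepProd) :=
    hiso.isClosedEmbedding.isClosedMap _ (isClosed_generatedCStar _)
  have hle : D ≤ C := generatedCStar_le hC (by
    rintro _ ⟨p, rfl⟩
    exact ⟨Λ.s p.2.2, subset_generatedCStar _ ⟨p, rfl⟩, rfl⟩)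
  refine eq_top_iff.2 fun a _ => ?_
  obtain ⟨b, hb, hba⟩ := hle (show Λ.incl a ∈ D from a.2)
  rwa [← hiso.injective hba]

variable {Λ}

/-- A homomorphism of `C^*(Λ)` maps into the `C^*`-algebra generated by the image of `s`. -/
theorem apply_mem_generatedCStar {B : Type*} [NonUnitalCStarAlgebra B] (π : Λ.CStar →⋆ₙₐ[ℂ] B)
    (a : Λ.CStar) : π a ∈ generatedCStar (familyRange fun _ _ f => π (Λ.s f)) := by
  have hπ : Continuous π := map_continuous π
  let C := (generatedCStar (familyRange fun _ _ f => π (Λ.s f))).comap π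
  have hC : IsClosed (C : Set Λ.CStar) := (isClosed_generatedCStar _).preimage hπ
  have h : familyRange Λ.s ⊆ C := by
    rintro _ ⟨p, rfl⟩
    exact subset_generatedCStar _ ⟨p, rfl⟩
  have := generatedCStar_le hC h
  rw [generatedCStar_s] at this
  exact this (Set.mem_univ a)

theorem hom_ext {B : Type*} [NonUnitalCStarAlgebra B] {π ρ : Λ.CStar →⋆ₙₐ[ℂ] B}
    (h : ∀ ⦃v w : Λ.Vertex⦄ (f : v ⟶ w), π (Λ.s f) = ρ (Λ.s f)) : π = ρ := by
  have hC : IsClosed (NonUnitalStarAlgHom.equalizer π ρ : Set Λ.CStar) :=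
    isClosed_eq (map_continuous π) (map_continuous ρ)
  have := generatedCStar_le (S := familyRange Λ.s) hC (by rintro _ ⟨p, rfl⟩; exact h p.2.2)
  rw [generatedCStar_s] at this
  ext a
  exact this (Set.mem_univ a)

/-- The universal property of `C^*(Λ)`. -/
theorem existsUnique_lift {B : Type w} [NonUnitalCStarAlgebra B]
    {t : ∀ ⦃v w : Λ.Vertex⦄, (v ⟶ w) → B} (ht : Λ.IsCuntzKriegerFamily t) :
    ∃! π : Λ.CStar →⋆ₙₐ[ℂ] B, ∀ ⦃v w : Λ.Vertex⦄ (f : v ⟶ w), π (Λ.s f) = t f := by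
  refine existsUnique_of_exists_of_unique ?_ fun π ρ hπ hρ => hom_ext fun v w f => by
    rw [hπ, hρ]
  have hsmall : Small.{0} (generatedCStar (familyRange t)) :=
    small_generatedCStar (Set.countable_range _)
  obtain ⟨A, _, f, g, hfg⟩ := exists_copy (generatedCStar (familyRange t))
  let ι : generatedCStar (familyRange t) →⋆ₙₐ[ℂ] B :=
    NonUnitalStarSubalgebraClass.subtype (generatedCStar (familyRange t))
  let t' : ∀ ⦃v w : Λ.Vertex⦄, (v ⟶ w) → generatedCStar (familyRange t) := fun v w f =>
    ⟨t f, subset_generatedCStar _ ⟨⟨v, w, f⟩, rfl⟩⟩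
  have ht' : Λ.IsCuntzKriegerFamily t' :=
    .of_jointly_injective (ι := Unit) (fun _ => ι) (fun _ _ h => Subtype.ext (h ())) fun _ => ht
  let i : Λ.Rep := ⟨_, _, ht'.map g⟩
  refine ⟨(ι.comp f).comp (Λ.coord i), fun v w p => ?_⟩
  change ι (f (g (t' p))) = t p
  rw [hfg]
  rfl

/-- The homomorphism `π_t` of `C^*(Λ)` with `π_t(s_f) = t_f`. -/
def lift {B : Type w} [NonUnitalCStarAlgebra B] {t : ∀ ⦃v w : Λ.Vertex⦄, (v ⟶ w) → B}
    (ht : Λ.IsCuntzKriegerFamily t) : Λ.CStar →⋆ₙₐ[ℂ] B :=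
  (existsUnique_lift ht).choose

@[simp]
theorem lift_s {B : Type w} [NonUnitalCStarAlgebra B] {t : ∀ ⦃v w : Λ.Vertex⦄, (v ⟶ w) → B}
    (ht : Λ.IsCuntzKriegerFamily t) ⦃v w : Λ.Vertex⦄ (f : v ⟶ w) : lift ht (Λ.s f) = t f :=
  (existsUnique_lift ht).choose_spec.1 f

/-- `z ^ m = z_1 ^ m_1 ⋯ z_k ^ m_k` for `z` in the `k`-torus. -/
def torusPow (z : Fin k → Circle) (m : Fin k → ℕ) : Circle := ∏ i, z i ^ m i

lemma torusPow_add (z : Fin k → Circle) (m n : Fin k → ℕ) :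
    torusPow z (m + n) = torusPow z m * torusPow z n := by
  simp [torusPow, pow_add, Finset.prod_mul_distrib]

lemma torusPow_zero (z : Fin k → Circle) : torusPow z 0 = 1 := by simp [torusPow]

lemma mul_torusPow (y z : Fin k → Circle) (m : Fin k → ℕ) :
    torusPow (y * z) m = torusPow y m * torusPow z m := by
  simp [torusPow, mul_pow, Finset.prod_mul_distrib]

lemma one_torusPow (m : Fin k → ℕ) : torusPow (1 : Fin k → Circle) m = 1 := by
  simp [torusPow]

theorem IsCuntzKriegerFamily.twist {B : Type*} [NonUnitalCStarAlgebra B]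
    {t : ∀ ⦃v w : Λ.Vertex⦄, (v ⟶ w) → B} (ht : Λ.IsCuntzKriegerFamily t) (z : Fin k → Circle) :
    Λ.IsCuntzKriegerFamily (fun _ _ f => (torusPow z (Λ.deg f) : ℂ) • t f) := by
  have hid (v : Λ.Vertex) : (torusPow z (Λ.deg (𝟙 v)) : ℂ) • t (𝟙 v) = t (𝟙 v) := by
    rw [Λ.deg_id, torusPow_zero, Circle.coe_one, one_smul]
  have hcc (c : Circle) : star (c : ℂ) * (c : ℂ) = 1 := by
    change (starRingEnd ℂ) (c : ℂ) * (c : ℂ) = 1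
    rw [← Circle.coe_inv_eq_conj, ← Circle.coe_mul, inv_mul_cancel, Circle.coe_one]
  have hrange {v w : Λ.Vertex} (f : v ⟶ w) :
      ((torusPow z (Λ.deg f) : ℂ) • t f) * star ((torusPow z (Λ.deg f) : ℂ) • t f)
        = t f * star (t f) := by
    rw [star_smul, smul_mul_smul_comm, mul_comm, hcc, one_smul]
  refine ⟨fun v w f => ?_, fun v => ?_, fun v w h => ?_, fun a b c g f => ?_,
    fun a b w f g => ?_, fun a b v w f g h => ?_, fun v l hl hE => ?_⟩
  · rw [hrange, mul_smul_comm, ht.partialIsometry]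
  · rw [hid]
    exact ht.isStarProjection v
  · rw [hid, hid, ht.orthogonal h]
  · rw [smul_mul_smul_comm, ht.comp, Λ.deg_comp, torusPow_add, Circle.coe_mul]
  · rw [star_smul, smul_mul_smul_comm, ht.adjoint_mul, Finset.smul_sum]
    refine Finset.sum_congr rfl fun p hp => ?_
    have h1 : p.2.1 ≫ f = p.2.2 ≫ g := ((Set.Finite.mem_toFinset _).1 hp).1
    have h2 : Λ.deg f + Λ.deg p.2.1 = Λ.deg g + Λ.deg p.2.2 := by
      rw [← Λ.deg_comp, ← Λ.deg_comp, h1]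
    have h3 : (torusPow z (Λ.deg f) : ℂ) * torusPow z (Λ.deg p.2.1)
        = torusPow z (Λ.deg g) * torusPow z (Λ.deg p.2.2) := by
      rw [← Circle.coe_mul, ← Circle.coe_mul, ← torusPow_add, ← torusPow_add, h2]
    rw [star_smul, smul_mul_smul_comm]
    congr 1
    have h4 := hcc (torusPow z (Λ.deg f))
    have h5 := hcc (torusPow z (Λ.deg p.2.2))
    linear_combination
      (-(star (torusPow z (Λ.deg f) : ℂ)) * star (torusPow z (Λ.deg p.2.2) : ℂ)) * h3
      + torusPow z (Λ.deg p.2.1) * star (torusPow z (Λ.deg p.2.2) : ℂ) * h4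
      - star (torusPow z (Λ.deg f) : ℂ) * torusPow z (Λ.deg g) * h5
  · rw [star_smul, smul_mul_smul_comm, ht.adjoint_mul_of_ne f g h, smul_zero]
  · rw [← ht.gapProd_eq_zero l hl hE]
    simp only [gapProd, hrange, hid]

variable (Λ)

/-- The automorphism `γ_z` of `C^*(Λ)`, as a homomorphism: `γ_z(s_f) = z ^ d(f) s_f`. -/
def gaugeHom (z : Fin k → Circle) : Λ.CStar →⋆ₙₐ[ℂ] Λ.CStar :=
  lift (Λ.isCuntzKriegerFamily_s.twist z)

lemma gaugeHom_s (z : Fin k → Circle) ⦃v w : Λ.Vertex⦄ (f : v ⟶ w) :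
    Λ.gaugeHom z (Λ.s f) = (torusPow z (Λ.deg f) : ℂ) • Λ.s f :=
  lift_s _ f

lemma gaugeHom_mul (y z : Fin k → Circle) (a : Λ.CStar) :
    Λ.gaugeHom (y * z) a = Λ.gaugeHom y (Λ.gaugeHom z a) := by
  have : Λ.gaugeHom (y * z) = (Λ.gaugeHom y).comp (Λ.gaugeHom z) := hom_ext fun v w f => by
    rw [NonUnitalStarAlgHom.comp_apply, gaugeHom_s, gaugeHom_s, map_smul, gaugeHom_s, smul_smul,
      mul_torusPow, mul_comm, Circle.coe_mul]
  rw [this, NonUnitalStarAlgHom.comp_apply]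

lemma gaugeHom_one (a : Λ.CStar) : Λ.gaugeHom 1 a = a := by
  have : Λ.gaugeHom 1 = NonUnitalStarAlgHom.id ℂ Λ.CStar := hom_ext fun v w f => by
    rw [gaugeHom_s, one_torusPow, Circle.coe_one, one_smul]
    rfl
  rw [this]
  rfl

/-- The gauge action `γ` of the `k`-torus on `C^*(Λ)`, determined by `γ_z(s_f) = z ^ d(f) s_f`. -/
def gauge : (Fin k → Circle) →* (Λ.CStar ≃⋆ₐ[ℂ] Λ.CStar) where
  toFun z :=
    { toFun := Λ.gaugeHom z
      invFun := Λ.gaugeHom z⁻¹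
      left_inv := fun a => by rw [← gaugeHom_mul, inv_mul_cancel, gaugeHom_one]
      right_inv := fun a => by rw [← gaugeHom_mul, mul_inv_cancel, gaugeHom_one]
      map_mul' := map_mul _
      map_add' := map_add _
      map_star' := map_star _
      map_smul' := map_smul _ }
  map_one' := by ext a; exact Λ.gaugeHom_one a
  map_mul' y z := by ext a; exact Λ.gaugeHom_mul y z a

end KGraph

end

/-! Call the span of the products t_p t_q^* with d(p) = d(q) the core. Averaging over the gauge
action sends C^*(Λ) into the closure of the core, so the theorem reduces to showing that π is
isometric there. If π(a) = 0, equivariance gives π(γ_z(a)) = 0 for all z, so π kills the average of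
γ_z(a^* a). Isometry makes that average zero, and since the integrand is positive and continuous,
γ_z(a) = 0 for every z; take z = 1.

Injectivity on the core is proved one degree at a time. Let F be a finite set of degrees closed
under joins, n a further degree with n ∨ m in F for all m in F, and let π kill x = b + y with b of
degree n and y supported in F. Compressing x to t_p^* x t_q isolates a coefficient of b: it is c t_v
plus an element of the core, where v is the common source of p and q. If c ≠ 0, then as π(t_v) ≠ 0
for every vertex, the paths with range v that occur as left factors in that element must be
exhaustive. Relation (iv), expanded, then rewrites t_v through higher degrees, so that t_p t_q^*
already lies in the core over F (`id_mem_core_of_map_eq_zero`,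
`mem_core_of_mem_core_insert_of_map_eq_zero`). Removing minimal degrees in turn leaves only x = 0.

Injectivity on this dense subalgebra gives isometry because each element of the core is algebraic
over ℂ: matrix units handle a single degree, and the core over F is an ideal in the core over F ∪
{n} (`isIntegral_of_mem_core`). A self-adjoint algebraic element generates a finite-dimensional
C^*-algebra, on which the injective π is isometric (`norm_map_eq_of_isIntegral`). -/

namespace KGraph

variable {k : ℕ} {Λ : KGraph.{u} k}

/-! ### Unique factorisation and the basic relations of a Cuntz–Krieger family. -/

/-- The paths of `Λ`, with their source and range. -/
abbrev Path (Λ : KGraph.{u} k) : Type u := Σ v w : Λ.Vertex, v ⟶ w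

/-- The degree of a path. -/
abbrev Path.deg (p : Λ.Path) : Fin k → ℕ := Λ.deg p.2.2

/-- The value of a family at a path. -/
abbrev Path.val {A : Type*} (t : ∀ ⦃v w : Λ.Vertex⦄, (v ⟶ w) → A) (p : Λ.Path) : A := t p.2.2

/-- The elements `t_p t_q^*` with `d(p) = d(q) = n`. -/
def coreUnits {A : Type*} [NonUnitalCStarAlgebra A] (t : ∀ ⦃v w : Λ.Vertex⦄, (v ⟶ w) → A)
    (n : Fin k → ℕ) : Set A :=
  {x | ∃ p q : Λ.Path, p.deg = n ∧ q.deg = n ∧ p.val t * star (q.val t) = x}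

/-- The span of the elements `t_p t_q^*` with `d(p) = d(q) ∈ D`. -/
def core {A : Type*} [NonUnitalCStarAlgebra A] (t : ∀ ⦃v w : Λ.Vertex⦄, (v ⟶ w) → A)
    (D : Set (Fin k → ℕ)) : Submodule ℂ A :=
  Submodule.span ℂ (⋃ n ∈ D, coreUnits t n)

/-- Two paths of the same degree with a common extension of that degree are equal. -/
lemma eq_of_comp_eq {a b c v : Λ.Vertex} {f : a ⟶ v} {g : b ⟶ v} {x : c ⟶ a} {y : c ⟶ b}
    (h : x ≫ f = y ≫ g) (hd : Λ.deg f = Λ.deg g) :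
    (⟨a, f, x⟩ : Σ u : Λ.Vertex, (u ⟶ v) × (c ⟶ u)) = ⟨b, g, y⟩ := by
  have h2 : Λ.deg f + Λ.deg x = Λ.deg g + Λ.deg y := by rw [← Λ.deg_comp, ← Λ.deg_comp, h]
  refine (Λ.factorisation (x ≫ f) (Λ.deg f) (Λ.deg x) (Λ.deg_comp _ _)).unique
    ⟨rfl, rfl, rfl⟩ ⟨hd.symm, ?_, h.symm⟩
  rw [hd] at h2
  exact (add_left_cancel h2).symm

/-- Both id ∘ x and x ∘ id factor x into two pieces of degree zero, so uniqueness identifies them.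
-/
lemma eq_id_of_deg_eq_zero {a b : Λ.Vertex} (x : a ⟶ b) (h : Λ.deg x = 0) :
    (⟨b, x⟩ : Σ u : Λ.Vertex, a ⟶ u) = ⟨a, 𝟙 a⟩ := by
  have := eq_of_comp_eq (f := 𝟙 b) (g := x) (x := x) (y := 𝟙 a) (by simp) (by rw [h, Λ.deg_id])
  rw [Sigma.mk.injEq] at this
  obtain ⟨rfl, h⟩ := this
  rw [heq_eq_eq, Prod.mk.injEq] at h
  rw [h.2]

lemma deg_of_mem_Lmin {a b v : Λ.Vertex} {f : a ⟶ v} {g : b ⟶ v}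
    {p : Σ u : Λ.Vertex, (u ⟶ a) × (u ⟶ b)} (hp : p ∈ Lmin f g) :
    Λ.deg f + Λ.deg p.2.1 = Λ.deg f ⊔ Λ.deg g ∧ Λ.deg g + Λ.deg p.2.2 = Λ.deg f ⊔ Λ.deg g := by
  rw [← Λ.deg_comp, ← Λ.deg_comp]
  exact ⟨hp.2, hp.1 ▸ hp.2⟩

lemma Lmin_self {a v : Λ.Vertex} (f : a ⟶ v) : Lmin f f = {⟨a, 𝟙 a, 𝟙 a⟩} := by
  ext p
  constructor
  · intro hp
    have h1 : Λ.deg p.2.1 = 0 := by simpa using (deg_of_mem_Lmin hp).1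
    obtain ⟨c, x, y⟩ := p
    -- Unique factorisation makes f left cancellable: f x = f y gives x = y.
    have h2 := eq_of_comp_eq hp.1 rfl
    simp only [Sigma.mk.injEq, heq_eq_eq, true_and, Prod.mk.injEq] at h2
    have h3 : x = y := h2
    subst h3
    have := eq_id_of_deg_eq_zero x h1
    rw [Sigma.mk.injEq] at this
    obtain ⟨rfl, h⟩ := this
    simp [eq_of_heq h]
  · rintro rfl
    exact ⟨rfl, by simp⟩

lemma Lmin_eq_empty {a b v : Λ.Vertex} {f : a ⟶ v} {g : b ⟶ v} (hd : Λ.deg f = Λ.deg g)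
    (h : (⟨a, v, f⟩ : Λ.Path) ≠ ⟨b, v, g⟩) : Lmin f g = ∅ := by
  refine Set.eq_empty_of_forall_notMem fun p hp => h ?_
  have := eq_of_comp_eq hp.1 hd
  rw [Sigma.mk.injEq] at this
  obtain ⟨rfl, h'⟩ := this
  rw [heq_eq_eq, Prod.mk.injEq] at h'
  rw [h'.1]

variable {A : Type*} [NonUnitalCStarAlgebra A] {t : ∀ ⦃v w : Λ.Vertex⦄, (v ⟶ w) → A}

lemma mul_star_mem_core {D : Set (Fin k → ℕ)} {a v w : Λ.Vertex} (f : a ⟶ v) (g : a ⟶ w)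
    (hf : Λ.deg f ∈ D) (h : Λ.deg f = Λ.deg g) : t f * star (t g) ∈ core t D :=
  Submodule.subset_span (Set.mem_iUnion₂_of_mem hf ⟨⟨a, v, f⟩, ⟨a, w, g⟩, rfl, h.symm, rfl⟩)

lemma core_mono {D E : Set (Fin k → ℕ)} (h : D ⊆ E) : core t D ≤ core t E :=
  Submodule.span_mono (Set.biUnion_subset_biUnion_left h)

variable [Λ.FinitelyAligned]

namespace IsCuntzKriegerFamily

lemma star_mul_self (ht : Λ.IsCuntzKriegerFamily t) {a v : Λ.Vertex} (f : a ⟶ v) :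
    star (t f) * t f = t (𝟙 a) := by
  have h : (FinitelyAligned.finite_Lmin f f).toFinset = {⟨a, 𝟙 a, 𝟙 a⟩} := by
    ext p
    rw [Set.Finite.mem_toFinset, Lmin_self]
    simp
  rw [ht.adjoint_mul, h, Finset.sum_singleton, (ht.isStarProjection a).isSelfAdjoint.star_eq,
    (ht.isStarProjection a).isIdempotentElem.eq]

/-- Together with `star_mul_self`, this makes the t_p t_q^* of a fixed degree multiply like matrix
units. Distinct paths of one degree have no minimal common extension, so relation (iii) has an empty
sum. -/
lemma star_mul_of_ne (ht : Λ.IsCuntzKriegerFamily t) {p q : Λ.Path} (hd : p.deg = q.deg)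
    (h : p ≠ q) : star (p.val t) * q.val t = 0 := by
  obtain ⟨a, v, f⟩ := p
  obtain ⟨b, w, g⟩ := q
  by_cases hvw : v = w
  · subst hvw
    rw [ht.adjoint_mul, Set.Finite.toFinset_eq_empty.2 (Lmin_eq_empty hd h), Finset.sum_empty]
  · exact ht.adjoint_mul_of_ne _ _ hvw

lemma mul_id (ht : Λ.IsCuntzKriegerFamily t) {a v : Λ.Vertex} (f : a ⟶ v) :
    t f * t (𝟙 a) = t f := by
  rw [ht.comp, Category.id_comp]

lemma id_mul (ht : Λ.IsCuntzKriegerFamily t) {a v : Λ.Vertex} (f : a ⟶ v) :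
    t (𝟙 v) * t f = t f := by
  rw [ht.comp, Category.comp_id]

lemma star_id (ht : Λ.IsCuntzKriegerFamily t) (v : Λ.Vertex) : star (t (𝟙 v)) = t (𝟙 v) :=
  (ht.isStarProjection v).isSelfAdjoint.star_eq

lemma id_mul_star (ht : Λ.IsCuntzKriegerFamily t) {a v : Λ.Vertex} (f : a ⟶ v) :
    t (𝟙 a) * star (t f) = star (t f) := by
  rw [← ht.star_id, ← star_mul, ht.mul_id]

lemma mul_star_of_source_ne (ht : Λ.IsCuntzKriegerFamily t) {p q : Λ.Path} (h : p.1 ≠ q.1) :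
    p.val t * star (q.val t) = 0 := by
  rw [Path.val, Path.val, ← ht.mul_id p.2.2, ← ht.id_mul_star q.2.2, mul_assoc, ← mul_assoc (t (𝟙 _)),
    ht.orthogonal h, zero_mul, mul_zero]

/-- `t_p (t_x t_y^*) t_q^*` is again of the same form, when `p` and `q` extend. -/
lemma sandwich (ht : Λ.IsCuntzKriegerFamily t) {a b c v w : Λ.Vertex} (f : a ⟶ v) (g : b ⟶ w)
    (x : c ⟶ a) (y : c ⟶ b) :
    t f * (t x * star (t y)) * star (t g) = t (x ≫ f) * star (t (y ≫ g)) := by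
  rw [← ht.comp, ← ht.comp, star_mul]
  simp only [mul_assoc]

end IsCuntzKriegerFamily

end KGraph

/-! ### Products, compressions and inflations in the core. -/

namespace KGraph

variable {k : ℕ} {Λ : KGraph.{u} k} {A : Type*} [NonUnitalCStarAlgebra A]
  {t : ∀ ⦃v w : Λ.Vertex⦄, (v ⟶ w) → A}

lemma core_induction {D : Set (Fin k → ℕ)} {M : Submodule ℂ A} (L : A →ₗ[ℂ] A)
    (h : ∀ p q : Λ.Path, p.deg = q.deg → p.deg ∈ D → L (p.val t * star (q.val t)) ∈ M)
    {x : A} (hx : x ∈ core t D) : L x ∈ M := by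
  have hle : core t D ≤ M.comap L := Submodule.span_le.2 fun y hy => by
    obtain ⟨n, hn, p, q, rfl, hq, rfl⟩ := Set.mem_iUnion₂.1 hy
    exact h p q hq.symm hn
  exact hle hx

lemma star_mem_core {D : Set (Fin k → ℕ)} {x : A} (hx : x ∈ core t D) : star x ∈ core t D := by
  induction hx using Submodule.span_induction with
  | mem y hy =>
    obtain ⟨n, hn, p, q, hp, hq, rfl⟩ := Set.mem_iUnion₂.1 hy
    exact Submodule.subset_span (Set.mem_iUnion₂_of_mem hn ⟨q, p, hq, hp, by simp⟩)
  | zero => simp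
  | add y z _ _ hy hz => rw [star_add]; exact add_mem hy hz
  | smul c y _ hy => rw [star_smul]; exact Submodule.smul_mem _ _ hy

/-- An element involves finitely many degrees. An order ideal below one N is used because it is both
finite and closed under joins, as `supClosed_induction` requires. -/
lemma exists_core_Iic {x : A} (hx : x ∈ core t Set.univ) : ∃ N, x ∈ core t (Set.Iic N) := by
  induction hx using Submodule.span_induction with
  | mem y hy =>
    obtain ⟨n, -, hy⟩ := Set.mem_iUnion₂.1 hy
    exact ⟨n, Submodule.subset_span (Set.mem_iUnion₂_of_mem (Set.mem_Iic.2 le_rfl) hy)⟩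
  | zero => exact ⟨0, zero_mem _⟩
  | add y z _ _ hy hz =>
    obtain ⟨M, hy⟩ := hy
    obtain ⟨N, hz⟩ := hz
    exact ⟨M ⊔ N, add_mem (core_mono (Set.Iic_subset_Iic.2 le_sup_left) hy)
      (core_mono (Set.Iic_subset_Iic.2 le_sup_right) hz)⟩
  | smul c y _ hy =>
    obtain ⟨N, hy⟩ := hy
    exact ⟨N, Submodule.smul_mem _ _ hy⟩

/-- The core of a union of two sets of degrees is the sum of the cores. -/
lemma core_union (D E : Set (Fin k → ℕ)) : core t (D ∪ E) = core t D ⊔ core t E := by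
  rw [core, Set.biUnion_union, Submodule.span_union]
  rfl

/-- A finite sum of elements `t_p t_q^*` with prescribed degree. -/
lemma exists_finsupp_of_mem_core {D : Set (Fin k → ℕ)} {x : A} (hx : x ∈ core t D) :
    ∃ c : {r : Λ.Path × Λ.Path // r.1.deg ∈ D ∧ r.2.deg = r.1.deg} →₀ ℂ,
      (c.sum fun r z => z • (r.1.1.val t * star (r.1.2.val t))) = x := by
  apply Finsupp.mem_span_range_iff_exists_finsupp.1
  refine Submodule.span_le.2 (fun y hy => ?_) hx
  obtain ⟨n, hn, p, q, hp, hq, rfl⟩ := Set.mem_iUnion₂.1 hy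
  exact Submodule.subset_span ⟨⟨(p, q), hp ▸ hn, hq.trans hp.symm⟩, rfl⟩

variable [Λ.FinitelyAligned]

namespace IsCuntzKriegerFamily

/-- Relation (iii) replaces t_q^* t_r by a sum over minimal common extensions, which lift both outer
paths to degree d(p) ∨ d(r). -/
lemma unit_mul_unit_mem_core (ht : Λ.IsCuntzKriegerFamily t) {D : Set (Fin k → ℕ)}
    {p q r s : Λ.Path} (hpq : p.deg = q.deg) (hrs : r.deg = s.deg) (hD : p.deg ⊔ r.deg ∈ D) :
    (p.val t * star (q.val t)) * (r.val t * star (s.val t)) ∈ core t D := by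
  by_cases h1 : p.1 = q.1
  swap
  · rw [ht.mul_star_of_source_ne h1, zero_mul]; exact zero_mem _
  by_cases h2 : r.1 = s.1
  swap
  · rw [ht.mul_star_of_source_ne h2, mul_zero]; exact zero_mem _
  obtain ⟨a, v, f⟩ := p
  obtain ⟨a', v', g⟩ := q
  obtain ⟨b, w, h⟩ := r
  obtain ⟨b', w', l⟩ := s
  dsimp only at h1 h2
  subst h1 h2
  have e : (t f * star (t g)) * (t h * star (t l)) = t f * (star (t g) * t h) * star (t l) := by
    simp only [mul_assoc]
  simp only [Path.val, e]
  by_cases h3 : v' = w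
  swap
  · rw [ht.adjoint_mul_of_ne g h h3]; simp
  subst h3
  rw [ht.adjoint_mul, Finset.mul_sum, Finset.sum_mul]
  refine Submodule.sum_mem _ fun x hx => ?_
  rw [ht.sandwich]
  obtain ⟨d1, d2⟩ := deg_of_mem_Lmin ((Set.Finite.mem_toFinset _).1 hx)
  simp only [Path.deg] at hpq hrs hD
  refine mul_star_mem_core _ _ ?_ ?_
  · rwa [Λ.deg_comp, hpq, d1, ← hpq]
  · rw [Λ.deg_comp, Λ.deg_comp, hpq, d1, ← hrs, d2]

lemma core_mul_mem (ht : Λ.IsCuntzKriegerFamily t) {D E H : Set (Fin k → ℕ)}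
    (hDE : ∀ m ∈ D, ∀ n ∈ E, m ⊔ n ∈ H) {x y : A} (hx : x ∈ core t D) (hy : y ∈ core t E) :
    x * y ∈ core t H := by
  refine core_induction (LinearMap.mulRight ℂ y) (fun p q hpq hp => ?_) hx
  rw [LinearMap.mulRight_apply]
  exact core_induction (LinearMap.mulLeft ℂ (p.val t * star (q.val t)))
    (fun r s hrs hr => ht.unit_mul_unit_mem_core hpq hrs (hDE _ hp _ hr)) hy

lemma id_mem_core (ht : Λ.IsCuntzKriegerFamily t) (v : Λ.Vertex) : t (𝟙 v) ∈ core t {0} := by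
  have := mul_star_mem_core (t := t) (D := {0}) (𝟙 v) (𝟙 v) (Λ.deg_id v) rfl
  rwa [ht.star_id, ht.mul_id] at this

/-- `t_f^* (t_p t_q^*) t_g` for paths with `d(f) = d(g)` and `d(p) = d(q)`. -/
lemma compress_unit_mem_core (ht : Λ.IsCuntzKriegerFamily t) {D : Set (Fin k → ℕ)}
    {f g p q : Λ.Path} (hfg : f.deg = g.deg) (hpq : p.deg = q.deg)
    (hD : ∀ r, r + f.deg = f.deg ⊔ p.deg → r ∈ D) :
    star (f.val t) * (p.val t * star (q.val t)) * g.val t ∈ core t D := by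
  obtain ⟨a, v, f⟩ := f
  obtain ⟨b, w, g⟩ := g
  obtain ⟨c, v', p⟩ := p
  obtain ⟨d, w', q⟩ := q
  simp only [Path.val, Path.deg] at hfg hpq hD ⊢
  have e : star (t f) * (t p * star (t q)) * t g = (star (t f) * t p) * (star (t q) * t g) := by
    simp only [mul_assoc]
  rw [e]
  by_cases h1 : v = v'
  swap
  · rw [ht.adjoint_mul_of_ne f p h1]; simp
  by_cases h2 : w' = w
  swap
  · rw [ht.adjoint_mul_of_ne q g h2]; simp
  subst h1 h2
  rw [ht.adjoint_mul, ht.adjoint_mul, Finset.sum_mul_sum]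
  refine Submodule.sum_mem _ fun x hx => Submodule.sum_mem _ fun y hy => ?_
  obtain ⟨d1, d2⟩ := deg_of_mem_Lmin ((Set.Finite.mem_toFinset _).1 hx)
  obtain ⟨d3, d4⟩ := deg_of_mem_Lmin ((Set.Finite.mem_toFinset _).1 hy)
  have d5 : Λ.deg x.2.2 = Λ.deg y.2.1 := by
    rw [← hpq, ← hfg, sup_comm, ← d2] at d3
    exact (add_left_cancel d3).symm
  have d6 : Λ.deg x.2.1 = Λ.deg y.2.2 := by
    rw [← hpq, ← hfg, sup_comm, ← d1] at d4
    exact (add_left_cancel d4).symm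
  have e : t x.2.1 * star (t x.2.2) * (t y.2.1 * star (t y.2.2)) =
      t x.2.1 * (star (t x.2.2) * t y.2.1) * star (t y.2.2) := by simp only [mul_assoc]
  rw [e]
  -- The two inner paths have equal degree, so they contribute only when they coincide, and then the
  -- middle factor is a vertex projection.
  by_cases h3 : (⟨x.1, c, x.2.2⟩ : Λ.Path) = ⟨y.1, d, y.2.1⟩
  · obtain ⟨x, x1, x2⟩ := x
    obtain ⟨y, y1, y2⟩ := y
    rw [Sigma.mk.injEq] at h3
    obtain ⟨rfl, h3⟩ := h3
    rw [heq_eq_eq, Sigma.mk.injEq] at h3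
    obtain ⟨rfl, h3⟩ := h3
    rw [heq_eq_eq] at h3
    dsimp only at h3 d1 d6 ⊢
    subst h3
    rw [ht.star_mul_self, ht.mul_id]
    exact mul_star_mem_core _ _ (hD _ (by rw [add_comm]; exact d1)) d6
  · have := ht.star_mul_of_ne d5 h3
    simp only [Path.val] at this
    rw [this]
    simp

lemma compress_mem_core (ht : Λ.IsCuntzKriegerFamily t) {D E : Set (Fin k → ℕ)} {f g : Λ.Path}
    (hfg : f.deg = g.deg) (hD : ∀ m ∈ E, ∀ r, r + f.deg = f.deg ⊔ m → r ∈ D) {y : A}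
    (hy : y ∈ core t E) : star (f.val t) * y * g.val t ∈ core t D :=
  core_induction (LinearMap.mulLeftRight ℂ (star (f.val t), g.val t))
    (fun _ _ hpq hp => ht.compress_unit_mem_core hfg hpq (hD _ hp)) hy

/-- `t_f x t_g^*` for `x` in the core. -/
lemma inflate_mem_core (ht : Λ.IsCuntzKriegerFamily t) {D E : Set (Fin k → ℕ)} {f g : Λ.Path}
    (hfg : f.deg = g.deg) (hD : ∀ r ∈ E, r + f.deg ∈ D) {y : A}
    (hy : y ∈ core t E) : f.val t * y * star (g.val t) ∈ core t D := by
  refine core_induction (LinearMap.mulLeftRight ℂ (f.val t, star (g.val t))) (fun p q hpq hp => ?_) hy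
  rw [LinearMap.mulLeftRight_apply]
  obtain ⟨a, v, f⟩ := f
  obtain ⟨b, w, g⟩ := g
  obtain ⟨c, v', p⟩ := p
  obtain ⟨d, w', q⟩ := q
  simp only [Path.val, Path.deg] at hfg hpq hp hD ⊢
  by_cases h1 : a = v'
  swap
  · rw [← ht.mul_id f, ← ht.id_mul p, mul_assoc (t f), ← mul_assoc (t (𝟙 a)), ← mul_assoc (t (𝟙 a)),
      ht.orthogonal h1]
    simp
  by_cases h2 : w' = b
  swap
  · rw [← ht.id_mul_star g, ← ht.id_mul q, star_mul, ht.star_id, mul_assoc, mul_assoc (t p),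
      mul_assoc (star (t q)), ← mul_assoc (t (𝟙 w')), ht.orthogonal h2]
    simp
  by_cases h3 : c = d
  swap
  · have := ht.mul_star_of_source_ne (p := ⟨c, v', p⟩) (q := ⟨d, w', q⟩) h3
    simp only [Path.val] at this
    rw [this]
    simp
  subst h1 h2 h3
  rw [ht.sandwich]
  refine mul_star_mem_core _ _ ?_ ?_
  · rw [Λ.deg_comp, add_comm]; exact hD _ hp
  · rw [Λ.deg_comp, Λ.deg_comp, hpq, hfg]

end IsCuntzKriegerFamily

end KGraph

/-! ### Injectivity on the core. -/

namespace KGraph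

variable {k : ℕ} {Λ : KGraph.{u} k} {A : Type*} [NonUnitalCStarAlgebra A]
  {t : ∀ ⦃v w : Λ.Vertex⦄, (v ⟶ w) → A} [Λ.FinitelyAligned]
  {B : Type*} [NonUnitalCStarAlgebra B]

namespace IsCuntzKriegerFamily

/-- Expanding the product leaves t_v and products of range projections, whose degrees are joins of
degrees from the list. The term t_v is split off because it has degree 0, which need not belong to
D. -/
lemma gapProd_sub_id_mem_core (ht : Λ.IsCuntzKriegerFamily t) {D : Set (Fin k → ℕ)}
    (hD : SupClosed D) {v : Λ.Vertex} (l : List (Σ a : Λ.Vertex, a ⟶ v))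
    (hl : ∀ f ∈ l, Λ.deg f.2 ∈ D) : gapProd t l - t (𝟙 v) ∈ core t D := by
  induction l with
  | nil => simp [gapProd]
  | cons f l ih =>
    have hw := ih fun g hg => hl g (List.mem_cons_of_mem _ hg)
    have hf : t f.2 * star (t f.2) ∈ core t D :=
      mul_star_mem_core _ _ (hl f List.mem_cons_self) rfl
    have e : gapProd t (f :: l) = (t (𝟙 v) - t f.2 * star (t f.2)) * gapProd t l := rfl
    generalize gapProd t l = x at *
    obtain ⟨w, rfl⟩ : ∃ w, x = t (𝟙 v) + w := ⟨x - t (𝟙 v), by simp⟩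
    rw [add_sub_cancel_left] at hw
    have e2 : t f.2 * star (t f.2) * t (𝟙 v) = t f.2 * star (t f.2) := by
      rw [mul_assoc, ← ht.star_id v, ← star_mul, ht.id_mul]
    rw [e, sub_mul, mul_add, mul_add, e2, (ht.isStarProjection v).isIdempotentElem.eq]
    have e3 : t (𝟙 v) + t (𝟙 v) * w - (t f.2 * star (t f.2) + t f.2 * star (t f.2) * w) - t (𝟙 v) =
      t (𝟙 v) * w - (t f.2 * star (t f.2) + t f.2 * star (t f.2) * w) := by abel
    rw [e3]
    refine sub_mem ?_ (add_mem hf ?_)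
    · exact ht.core_mul_mem (by simp) (ht.id_mem_core v) hw
    · exact ht.core_mul_mem (fun m hm n hn => hD hm hn) hf hw

/-- If a vertex projection agrees up to the kernel of `π` with an element of the core, then the
paths involved in that element are exhaustive, and the vertex projection is in the same core. -/
lemma id_mem_core_of_map_eq_zero (ht : Λ.IsCuntzKriegerFamily t) (π : A →⋆ₙₐ[ℂ] B)
    (hπ : ∀ v, π (t (𝟙 v)) ≠ 0) {D : Set (Fin k → ℕ)} (hD : SupClosed D) {a : Λ.Vertex} {z : A}
    (hz : z ∈ core t D) (h : π (t (𝟙 a) + z) = 0) : t (𝟙 a) ∈ core t D := by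
  classical
  obtain ⟨c, rfl⟩ := exists_finsupp_of_mem_core hz
  let j : (Σ b : Λ.Vertex, b ⟶ a) → Λ.Path := fun e => ⟨e.1, a, e.2⟩
  have hj : Function.Injective j := by
    rintro ⟨b, f⟩ ⟨b', f'⟩ h
    obtain rfl : b = b' := congrArg (fun p : Λ.Path => p.1) h
    simpa [j] using h
  -- The left-hand paths with range a in the terms of z, viewed as candidates for an exhaustive set.
  let G : Finset (Σ b : Λ.Vertex, b ⟶ a) :=
    (c.support.image fun r => r.1.1).preimage j hj.injOn
  have hG (e) : e ∈ G ↔ ∃ r ∈ c.support, r.1.1 = j e := by simp [G]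
  by_cases hex : Exhaustive {f | f ∈ G.toList}
  · have h0 := ht.gapProd_sub_id_mem_core hD G.toList fun f hf => by
      obtain ⟨r, -, hr⟩ := (hG f).1 (Finset.mem_toList.1 hf)
      have := r.2.1
      rwa [hr] at this
    rw [ht.gapProd_eq_zero _ G.nodup_toList hex, zero_sub] at h0
    simpa using h0
  -- A path g without common extension with any member of G satisfies t_g^* z = 0, so compressing
  -- t_a + z by g returns the projection at the source of g, and π kills it.
  · exfalso
    simp only [Exhaustive, not_forall, Finset.mem_toList, Set.mem_ofPred_eq, not_exists, not_and,
      Set.not_nonempty_iff_eq_empty] at hex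
    obtain ⟨b, g, hg⟩ := hex
    have h1 : star (t g) * (c.sum fun r z => z • (r.1.1.val t * star (r.1.2.val t))) = 0 := by
      rw [Finsupp.mul_sum]
      refine Finset.sum_eq_zero fun r hr => ?_
      dsimp only
      rw [mul_smul_comm, ← mul_assoc]
      have h2 : star (t g) * r.1.1.val t = 0 := by
        rw [← star_star (r.1.1.val t), ← star_mul, star_eq_zero]
        obtain ⟨⟨⟨b', a', p⟩, q⟩, hr'⟩ := r
        by_cases h3 : a' = a
        · subst h3
          have := hg ⟨b', p⟩ ((hG _).2 ⟨_, hr, rfl⟩)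
          dsimp only at this
          simp [Path.val, ht.adjoint_mul, this]
        · exact ht.adjoint_mul_of_ne _ _ h3
      rw [h2, zero_mul, smul_zero]
    apply hπ b
    have h2 : t (𝟙 b) =
        star (t g) * (t (𝟙 a) + c.sum fun r z => z • (r.1.1.val t * star (r.1.2.val t))) * t g := by
      rw [mul_add, h1, add_zero, mul_assoc, ht.id_mul, ht.star_mul_self]
    rw [h2, map_mul, map_mul, h, mul_zero, zero_mul]

/-- A matrix coefficient of a combination of the elements `t_p t_q^*` with `d(p) = d(q) = n`. -/
lemma compress_sum (ht : Λ.IsCuntzKriegerFamily t) {n : Fin k → ℕ}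
    (c : {r : Λ.Path × Λ.Path // r.1.deg ∈ ({n} : Set (Fin k → ℕ)) ∧ r.2.deg = r.1.deg} →₀ ℂ)
    (r : {r : Λ.Path × Λ.Path // r.1.deg ∈ ({n} : Set (Fin k → ℕ)) ∧ r.2.deg = r.1.deg})
    (hr : r.1.1.1 = r.1.2.1) :
    star (r.1.1.val t) * (c.sum fun r z => z • (r.1.1.val t * star (r.1.2.val t))) * r.1.2.val t =
      c r • t (𝟙 r.1.1.1) := by
  classical
  have h1 (s : {r : Λ.Path × Λ.Path // r.1.deg ∈ ({n} : Set (Fin k → ℕ)) ∧ r.2.deg = r.1.deg}) :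
      star (r.1.1.val t) * (s.1.1.val t * star (s.1.2.val t)) * r.1.2.val t =
        if s = r then t (𝟙 r.1.1.1) else 0 := by
    have e : star (r.1.1.val t) * (s.1.1.val t * star (s.1.2.val t)) * r.1.2.val t =
      (star (r.1.1.val t) * s.1.1.val t) * (star (s.1.2.val t) * r.1.2.val t) := by
      simp only [mul_assoc]
    rw [e]
    have d1 : r.1.1.deg = s.1.1.deg := (Set.mem_singleton_iff.1 r.2.1).trans s.2.1.symm
    have d2 : s.1.2.deg = r.1.2.deg := s.2.2.trans (d1.symm.trans r.2.2.symm)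
    split_ifs with h
    · subst h
      rw [ht.star_mul_self, ht.star_mul_self, hr, (ht.isStarProjection _).isIdempotentElem.eq]
    -- Different terms differ in the left or in the right path, and orthogonality at equal degree
    -- kills the corresponding factor.
    · by_cases h2 : r.1.1 = s.1.1
      · have h3 : s.1.2 ≠ r.1.2 := fun h3 => h (Subtype.ext (Prod.ext h2.symm h3))
        rw [ht.star_mul_of_ne d2 h3, mul_zero]
      · rw [ht.star_mul_of_ne d1 h2, zero_mul]
  rw [Finsupp.mul_sum, Finsupp.sum_mul]
  simp only [mul_smul_comm, smul_mul_assoc, h1]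
  rw [Finsupp.sum, Finset.sum_eq_single r]
  · simp
  · intro s _ hs; simp [hs]
  · intro h; simp [Finsupp.notMem_support_iff.1 h]

/-- Elements of the core killed by `π` do not involve a minimal degree. -/
lemma mem_core_of_mem_core_insert_of_map_eq_zero (ht : Λ.IsCuntzKriegerFamily t) (π : A →⋆ₙₐ[ℂ] B)
    (hπ : ∀ v, π (t (𝟙 v)) ≠ 0) {n : Fin k → ℕ} {F : Set (Fin k → ℕ)} (hF : SupClosed F)
    (hn : ∀ m ∈ F, n ⊔ m ∈ F) {x : A} (hx : x ∈ core t (insert n F)) (h : π x = 0) :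
    x ∈ core t F := by
  rw [← Set.singleton_union, core_union] at hx
  obtain ⟨b, hb, y, hy, rfl⟩ := Submodule.mem_sup.1 hx
  refine add_mem ?_ hy
  obtain ⟨c, rfl⟩ := exists_finsupp_of_mem_core hb
  refine Submodule.sum_mem _ fun r hr => Submodule.smul_mem _ _ ?_
  by_cases hs : r.1.1.1 = r.1.2.1
  swap
  · rw [ht.mul_star_of_source_ne hs]; exact zero_mem _
  have hc := Finsupp.mem_support_iff.1 hr
  have hrn : r.1.1.deg = n := r.2.1
  have hd : r.1.1.deg = r.1.2.deg := r.2.2.symm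
  -- Compression by paths of degree n sends a degree m to (n ∨ m) - n, and n ∨ m lies in F;
  -- inflation adds n back.
  let D : Set (Fin k → ℕ) := {m | m + n ∈ F}
  have hD : SupClosed D := fun m hm m' hm' => by
    have := hF hm hm'
    change (m ⊔ m') + n ∈ F
    convert this using 1
    funext i
    exact max_add _ _ _
  have hz := ht.compress_mem_core (D := D) (f := r.1.1) (g := r.1.2) hd (fun m hm s hs => by
    change s + n ∈ F
    rw [← hrn, hs, hrn]
    exact hn m hm) hy
  -- Compressing π(x) = 0 and dividing by the nonzero coefficient gives the relation for the vertex
  -- projection.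
  have hid : t (𝟙 r.1.1.1) ∈ core t D := by
    refine ht.id_mem_core_of_map_eq_zero π hπ hD (Submodule.smul_mem _ (c r)⁻¹ hz) ?_
    have e := congrArg (fun u => π (star (r.1.1.val t)) * u * π (r.1.2.val t)) h
    simp only [← map_mul] at e
    rw [mul_add, add_mul, ht.compress_sum c r hs] at e
    have e2 : t (𝟙 r.1.1.1) = (c r)⁻¹ • (c r • t (𝟙 r.1.1.1)) := by
      rw [smul_smul, inv_mul_cancel₀ hc, one_smul]
    rw [e2, ← smul_add, map_smul, e]
    simp
  have := ht.inflate_mem_core (D := F) (f := r.1.1) (g := r.1.2) hd (fun m hm => by rw [hrn]; exact hm) hid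
  rwa [Path.val, ht.mul_id] at this

end IsCuntzKriegerFamily

/-- Induction on finite sets closed under joins, by removal of minimal elements. -/
lemma supClosed_induction {α : Type*} [SemilatticeSup α] {P : Set α → Prop} (h0 : P ∅)
    (h1 : ∀ (n : α) (F : Set α), SupClosed F → (∀ m ∈ F, n ⊔ m ∈ F) → P F → P (insert n F))
    {F : Set α} (hfin : F.Finite) (hF : SupClosed F) : P F := by
  induction hc : F.ncard generalizing F with
  | zero => exact (Set.ncard_eq_zero hfin).1 hc ▸ h0
  | succ c ih =>
    obtain ⟨n, hn⟩ := hfin.exists_minimal ((Set.ncard_pos hfin).1 (hc ▸ c.succ_pos))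
    -- If m' ∨ m were the minimal element n, then m ≤ n, and minimality would force m = n.
    have key (m) (hm : m ∈ F \ {n}) (m') (hm' : m' ∈ F) : m' ⊔ m ∈ F \ {n} := by
      refine ⟨hF hm' hm.1, fun h => hm.2 ?_⟩
      have hle : m ≤ n := Set.mem_singleton_iff.1 h ▸ le_sup_right
      exact le_antisymm hle (hn.2 hm.1 hle)
    have hcl : SupClosed (F \ {n}) := fun m hm m' hm' => key m' hm' m hm.1
    rw [← Set.insert_sdiff_self_of_mem hn.1]
    exact h1 n _ hcl (fun m hm => key m hm n hn.1) (ih hfin.sdiff hcl (by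
      rw [Set.ncard_sdiff_singleton_of_mem hn.1, hc, Nat.add_sub_cancel]))

/-- A homomorphism which does not vanish on the vertex projections is injective on the core. -/
lemma IsCuntzKriegerFamily.eq_zero_of_mem_core (ht : Λ.IsCuntzKriegerFamily t) (π : A →⋆ₙₐ[ℂ] B)
    (hπ : ∀ v, π (t (𝟙 v)) ≠ 0) {x : A} (hx : x ∈ core t Set.univ) (h : π x = 0) : x = 0 := by
  obtain ⟨N, hx⟩ := exists_core_Iic hx
  refine supClosed_induction (P := fun F => ∀ x ∈ core t F, π x = 0 → x = 0) ?_
    (fun n F hF hn ih x hx h => ih x (ht.mem_core_of_mem_core_insert_of_map_eq_zero π hπ hF hn hx h) h)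
    (Set.finite_Iic N) (fun m hm n hn => Set.mem_Iic.2 (sup_le (Set.mem_Iic.1 hm) (Set.mem_Iic.1 hn))) x hx h
  intro x hx _
  simpa [core] using hx

end KGraph

/-! ### Algebraic elements and isometry of injective homomorphisms. -/

section Integral

/-- The powers telescope: x^(n+1) - b^(n+1) = x (x^n - b^n) + (x - b) b^n. Only stability under left
multiplication by x and right multiplication by b is needed. -/
lemma Submodule.aeval_sub_aeval_mem {R U : Type*} [CommRing R] [Ring U] [Algebra R U]
    (J : Submodule R U) {x b : U} (h : x - b ∈ J) (hx : ∀ j ∈ J, x * j ∈ J)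
    (hb : ∀ j ∈ J, j * b ∈ J) (p : Polynomial R) :
    Polynomial.aeval x p - Polynomial.aeval b p ∈ J := by
  have h1 (n : ℕ) : (x - b) * b ^ n ∈ J := by
    induction n with
    | zero => simpa using h
    | succ n ih => rw [pow_succ, ← mul_assoc]; exact hb _ ih
  have h2 (n : ℕ) : x ^ n - b ^ n ∈ J := by
    induction n with
    | zero => simp
    | succ n ih =>
      have : x ^ (n + 1) - b ^ (n + 1) = x * (x ^ n - b ^ n) + (x - b) * b ^ n := by
        rw [pow_succ', pow_succ', mul_sub, sub_mul]; abel
      rw [this]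
      exact add_mem (hx _ ih) (h1 n)
  rw [Polynomial.aeval_eq_sum_range, Polynomial.aeval_eq_sum_range, ← Finset.sum_sub_distrib]
  refine Submodule.sum_mem _ fun i _ => ?_
  rw [← smul_sub]
  exact J.smul_mem _ (h2 i)

variable {A B : Type*} [NonUnitalCStarAlgebra A] [NonUnitalCStarAlgebra B]

lemma Unitization.isIntegral_inr_of_finite (N : NonUnitalSubalgebra ℂ A) [Module.Finite ℂ N] {b : A}
    (hb : b ∈ N) : IsIntegral ℂ (b : Unitization ℂ A) := by
  have : Module.Finite ℂ (Unitization ℂ N) :=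
    .equiv (Unitization.linearEquiv ℂ ℂ N).symm
  have h := IsIntegral.of_finite ℂ ((⟨b, hb⟩ : N) : Unitization ℂ N)
  have h2 := h.map (Unitization.lift ((Unitization.inrNonUnitalAlgHom ℂ A).comp
    (NonUnitalSubalgebraClass.subtype N)))
  simpa using h2

/-- A perturbation of an integral element by an ideal of integral elements is integral. -/
lemma Unitization.isIntegral_inr_add {J : Submodule ℂ A} {b y : A} (hy : y ∈ J)
    (hJ : ∀ j ∈ J, IsIntegral ℂ (j : Unitization ℂ A)) (hx : ∀ j ∈ J, (b + y) * j ∈ J)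
    (hb : ∀ j ∈ J, j * b ∈ J) (h : IsIntegral ℂ (b : Unitization ℂ A)) :
    IsIntegral ℂ ((b + y : A) : Unitization ℂ A) := by
  obtain ⟨p, hp, h0⟩ := h
  have h1 := (J.map (Unitization.inrHom ℂ ℂ A)).aeval_sub_aeval_mem
    (x := ((b + y : A) : Unitization ℂ A)) (b := b) ⟨y, hy, by simp⟩
    (by
      rintro _ ⟨j, hj, rfl⟩
      exact ⟨_, hx j hj, by simp⟩)
    (by
      rintro _ ⟨j, hj, rfl⟩
      exact ⟨_, hb j hj, by simp⟩) p
  rw [← Polynomial.aeval_def] at h0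
  rw [h0, sub_zero] at h1
  obtain ⟨j, hj, hj'⟩ := h1
  have hint : IsIntegral ℂ (Polynomial.aeval ((b + y : A) : Unitization ℂ A) p) := hj' ▸ hJ j hj
  obtain ⟨q, hq, hq0⟩ := hint
  -- If p annihilates b and q annihilates p(b + y), then q ∘ p annihilates b + y. For it to be monic
  -- p must be nonconstant; a constant monic p would give 1 = 0 in the unitization.
  refine ⟨q.comp p, hq.comp hp fun hd => ?_, ?_⟩
  swap
  · rwa [← Polynomial.aeval_def, Polynomial.aeval_comp]
  rw [hp.natDegree_eq_zero.1 hd] at h0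
  simp at h0

/-- No completeness of C is needed: h generates a finite-dimensional, hence closed, star subalgebra
inside C, and an injective homomorphism of C^*-algebras is isometric. -/
lemma norm_map_eq_of_isIntegral (C : NonUnitalStarSubalgebra ℂ A) (π : A →⋆ₙₐ[ℂ] B)
    (hπ : ∀ x ∈ C, π x = 0 → x = 0) {h : A} (hh : h ∈ C) (hsa : IsSelfAdjoint h)
    (hi : IsIntegral ℂ (h : Unitization ℂ A)) : ‖π h‖ = ‖h‖ := by
  let D : NonUnitalStarSubalgebra ℂ A := NonUnitalStarAlgebra.adjoin ℂ {h}
  have hD : D ≤ C := NonUnitalStarAlgebra.adjoin_le (by simpa using hh)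
  let E := Algebra.adjoin ℂ {(h : Unitization ℂ A)}
  have hE : Module.Finite ℂ E := .of_fg hi.fg_adjoin_singleton
  have hDE (x) (hx : x ∈ D) : (x : Unitization ℂ A) ∈ E := by
    have : D.toNonUnitalSubalgebra ≤ E.toNonUnitalSubalgebra.comap
        (Unitization.inrNonUnitalAlgHom ℂ A) := by
      refine NonUnitalAlgebra.adjoin_le ?_
      rw [Set.star_singleton, hsa.star_eq, Set.union_self, Set.singleton_subset_iff]
      exact Algebra.subset_adjoin rfl
    exact this hx
  have hfin : FiniteDimensional ℂ D := by
    let L : D →ₗ[ℂ] E :=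
      ((Unitization.inrHom ℂ ℂ A).comp D.toSubmodule.subtype).codRestrict
          E.toSubmodule fun x => hDE x x.2
    refine FiniteDimensional.of_injective L fun x y hxy => ?_
    exact Subtype.ext (Unitization.inr_injective (congrArg Subtype.val hxy))
  have hcl : IsClosed (D : Set A) := Submodule.closed_of_finiteDimensional D.toSubmodule
  let _ : NonUnitalCStarAlgebra D := NonUnitalStarSubalgebra.nonUnitalCStarAlgebra D (h_closed := hcl)
  let φ : D →⋆ₙₐ[ℂ] B := π.comp (NonUnitalStarSubalgebraClass.subtype D)
  have hφ : Function.Injective φ := (injective_iff_map_eq_zero φ).2 fun x hx =>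
    Subtype.ext (hπ x (hD x.2) hx)
  exact NonUnitalStarAlgHom.norm_map φ hφ ⟨h, NonUnitalStarAlgebra.self_mem_adjoin_singleton ℂ h⟩

/-- The C^*-identity reduces the claim to the self-adjoint element x^* x. -/
lemma norm_map_eq_of_forall_isIntegral (C : NonUnitalStarSubalgebra ℂ A) (π : A →⋆ₙₐ[ℂ] B)
    (hπ : ∀ x ∈ C, π x = 0 → x = 0) (hC : ∀ x ∈ C, IsIntegral ℂ (x : Unitization ℂ A)) {x : A}
    (hx : x ∈ C) : ‖π x‖ = ‖x‖ := by
  have hm : star x * x ∈ C := mul_mem (star_mem hx) hx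
  have := norm_map_eq_of_isIntegral C π hπ hm (.star_mul_self x) (hC _ hm)
  rw [map_mul, map_star, CStarRing.norm_star_mul_self, CStarRing.norm_star_mul_self] at this
  nlinarith [norm_nonneg (π x), norm_nonneg x]

end Integral

/-! ### The core consists of algebraic elements; isometry on its closure. -/

namespace KGraph

variable {k : ℕ} {Λ : KGraph.{u} k} {A : Type*} [NonUnitalCStarAlgebra A]
  {t : ∀ ⦃v w : Λ.Vertex⦄, (v ⟶ w) → A} [Λ.FinitelyAligned]
  {B : Type*} [NonUnitalCStarAlgebra B]

namespace IsCuntzKriegerFamily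

lemma isIntegral_of_mem_core_singleton (ht : Λ.IsCuntzKriegerFamily t) {n : Fin k → ℕ} {b : A}
    (hb : b ∈ core t {n}) : IsIntegral ℂ (b : Unitization ℂ A) := by
  classical
  obtain ⟨c, rfl⟩ := exists_finsupp_of_mem_core hb
  -- Collecting left and right paths in one finite set makes the span of all t_p t_q^* over G × G
  -- closed under multiplication.
  let G : Finset Λ.Path := c.support.image (fun r => r.1.1) ∪ c.support.image (fun r => r.1.2)
  have hG (p) (hp : p ∈ G) : p.deg = n := by
    simp only [G, Finset.mem_union, Finset.mem_image] at hp
    obtain ⟨r, -, rfl⟩ | ⟨r, -, rfl⟩ := hp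
    · exact r.2.1
    · exact r.2.2.trans r.2.1
  let e : Λ.Path × Λ.Path → A := fun r => r.1.val t * star (r.2.val t)
  let M : Submodule ℂ A := Submodule.span ℂ (e '' (G ×ˢ G : Finset _))
  have hM (p q) (hp : p ∈ G) (hq : q ∈ G) : p.val t * star (q.val t) ∈ M :=
    Submodule.subset_span ⟨(p, q), by simp [hp, hq], rfl⟩
  have hmul : ∀ x ∈ M, ∀ y ∈ M, x * y ∈ M := by
    intro x hx y hy
    refine (Submodule.span_le (p := M.comap (LinearMap.mulRight ℂ y))).2 ?_ hx
    rintro _ ⟨⟨p, q⟩, hpq, rfl⟩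
    refine (Submodule.span_le (p := M.comap (LinearMap.mulLeft ℂ (e (p, q))))).2 ?_ hy
    rintro _ ⟨⟨r, s⟩, hrs, rfl⟩
    simp only [Finset.coe_product, Set.mem_prod, Finset.mem_coe] at hpq hrs
    change p.val t * star (q.val t) * (r.val t * star (s.val t)) ∈ M
    have e1 : p.val t * star (q.val t) * (r.val t * star (s.val t)) =
      p.val t * (star (q.val t) * r.val t) * star (s.val t) := by simp only [mul_assoc]
    by_cases h1 : q = r
    swap
    · rw [e1, ht.star_mul_of_ne ((hG _ hpq.2).trans (hG _ hrs.1).symm) h1]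
      simp
    by_cases h2 : p.1 = q.1
    swap
    · rw [ht.mul_star_of_source_ne h2, zero_mul]; exact zero_mem _
    have e2 : p.val t * t (𝟙 q.1) = p.val t := h2 ▸ ht.mul_id p.2.2
    rw [e1, ← h1, ht.star_mul_self, e2]
    exact hM _ _ hpq.1 hrs.2
  let N : NonUnitalSubalgebra ℂ A := { M with mul_mem' := fun hx hy => hmul _ hx _ hy }
  have : Module.Finite ℂ M := FiniteDimensional.span_of_finite ℂ ((Finset.finite_toSet _).image _)
  have : Module.Finite ℂ N := this
  refine Unitization.isIntegral_inr_of_finite N ?_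
  refine Submodule.sum_mem M fun r hr => M.smul_mem _ (hM _ _ ?_ ?_)
  · exact Finset.mem_union_left _ (Finset.mem_image_of_mem _ hr)
  · exact Finset.mem_union_right _ (Finset.mem_image_of_mem _ hr)

/-- The same removal of minimal degrees as for injectivity: multiplying degree n or F with F stays
in F, so the core over F acts as an ideal and `Unitization.isIntegral_inr_add` applies. -/
lemma isIntegral_of_mem_core (ht : Λ.IsCuntzKriegerFamily t) {x : A} (hx : x ∈ core t Set.univ) :
    IsIntegral ℂ (x : Unitization ℂ A) := by
  obtain ⟨N, hx⟩ := exists_core_Iic hx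
  refine supClosed_induction (P := fun F => ∀ x ∈ core t F, IsIntegral ℂ (x : Unitization ℂ A)) ?_
    ?_ (Set.finite_Iic N)
    (fun m hm n hn => Set.mem_Iic.2 (sup_le (Set.mem_Iic.1 hm) (Set.mem_Iic.1 hn))) x hx
  · intro x hx
    have : x = 0 := by simpa [core] using hx
    rw [this, Unitization.inr_zero]
    exact isIntegral_zero
  · intro n F hF hn ih x hx
    rw [← Set.singleton_union, core_union] at hx
    obtain ⟨b, hb, y, hy, rfl⟩ := Submodule.mem_sup.1 hx
    have h1 : ∀ m ∈ ({n} : Set (Fin k → ℕ)), ∀ m' ∈ F, m ⊔ m' ∈ F := fun m hm m' hm' => by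
      rw [Set.mem_singleton_iff.1 hm]
      exact hn m' hm'
    refine Unitization.isIntegral_inr_add hy ih (fun j hj => ?_) (fun j hj => ?_)
      (ht.isIntegral_of_mem_core_singleton hb)
    · rw [add_mul]
      exact add_mem (ht.core_mul_mem h1 hb hj) (ht.core_mul_mem (fun m hm m' hm' => hF hm hm') hy hj)
    · exact ht.core_mul_mem (fun m hm m' hm' => by rw [sup_comm]; exact h1 m' hm' m hm) hj hb

/-- A homomorphism which does not vanish on the vertex projections is isometric on the closure of
the core. -/
lemma norm_map_of_mem_closure_core (ht : Λ.IsCuntzKriegerFamily t) (π : A →⋆ₙₐ[ℂ] B)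
    (hπ : ∀ v, π (t (𝟙 v)) ≠ 0) {x : A} (hx : x ∈ closure (core t Set.univ : Set A)) :
    ‖π x‖ = ‖x‖ := by
  let C : NonUnitalStarSubalgebra ℂ A :=
    { core t Set.univ with
      mul_mem' := fun hx hy => ht.core_mul_mem (fun _ _ _ _ => Set.mem_univ _) hx hy
      star_mem' := fun hx => star_mem_core hx }
  have hcl : IsClosed {x : A | ‖π x‖ = ‖x‖} :=
    isClosed_eq (map_continuous π).norm continuous_norm
  refine closure_minimal (fun y hy => ?_) hcl hx
  exact norm_map_eq_of_forall_isIntegral C π (fun z hz h => ht.eq_zero_of_mem_core π hπ hz h)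
    (fun z hz => ht.isIntegral_of_mem_core hz) hy

end IsCuntzKriegerFamily

end KGraph

/-! ### Averaging over the torus. -/

open MeasureTheory in
/-- A continuous function `g` with values in a `C^*`-algebra vanishes if the integral of `g^* g`
is zero. -/
lemma eq_zero_of_integral_star_mul_self_eq_zero {X A : Type*} [TopologicalSpace X] [MeasurableSpace X]
    [OpensMeasurableSpace X] {μ : Measure X} [μ.IsOpenPosMeasure]
    [NonUnitalCStarAlgebra A] {g : X → A} (hg : Continuous g)
    (hi : Integrable (fun x => star (g x) * g x) μ) (h : ∫ x, star (g x) * g x ∂μ = 0) (x : X) :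
    g x = 0 := by
  let _ : PartialOrder A := CStarAlgebra.spectralOrder A
  have : StarOrderedRing A := CStarAlgebra.spectralOrderedRing A
  have h0 (x) : 0 ≤ star (g x) * g x := star_mul_self_nonneg _
  -- By positivity the integral over any subset lies between 0 and the total integral, which is 0.
  have hs (s : Set X) : ∫ x in s, star (g x) * g x ∂μ = 0 :=
    le_antisymm ((setIntegral_le_integral hi (.of_forall h0)).trans h.le)
      (integral_nonneg h0)
  have hae := hi.ae_eq_zero_of_forall_setIntegral_eq_zero fun s _ _ => hs s
  have := (Continuous.ae_eq_iff_eq μ (by fun_prop) continuous_const).1 hae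
  exact CStarRing.star_mul_self_eq_zero_iff _ |>.1 (congrFun this x)

namespace KGraph

variable {k : ℕ}

lemma exists_torusPow_ne {m n : Fin k → ℕ} (h : m ≠ n) :
    ∃ z : Fin k → Circle, torusPow z m ≠ torusPow z n := by
  obtain ⟨i, hi⟩ := Function.ne_iff.1 h
  have hN : (0 : ℝ) < m i + n i + 1 := by positivity
  -- The angle is small enough that its multiples by m_i and n_i lie in [0, 1], where the argument
  -- recovers them.
  let x : ℝ := 1 / (m i + n i + 1)
  have hp (l : Fin k → ℕ) : torusPow (Pi.mulSingle i (Circle.exp x)) l = Circle.exp (l i * x) := by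
    rw [torusPow, Finset.prod_eq_single i]
    · simp [← nsmul_eq_mul, Circle.exp_nsmul]
    · intro j _ hj; simp [hj]
    · simp
  have ha (l : ℕ) (hl : (l : ℝ) ≤ m i + n i) : Complex.arg (Circle.exp (l * x)) = l * x := by
    have h1 : (l : ℝ) * x ≤ 1 := by
      rw [mul_one_div, div_le_one hN]; linarith
    have h2 : 0 ≤ (l : ℝ) * x := by positivity
    exact Circle.arg_exp (by linarith [Real.pi_gt_three]) (by linarith [Real.pi_gt_three])
  refine ⟨Pi.mulSingle i (Circle.exp x), fun e => hi ?_⟩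
  rw [hp, hp] at e
  have e2 := congrArg (fun z : Circle => Complex.arg z) e
  rw [ha _ (by simp), ha _ (by simp)] at e2
  have hx : x ≠ 0 := by positivity
  exact_mod_cast mul_right_cancel₀ hx e2

lemma continuous_torusPow (m : Fin k → ℕ) : Continuous fun z : Fin k → Circle => torusPow z m := by
  unfold torusPow
  fun_prop

-- Translating by a point w where the two characters differ multiplies the integral by a constant
-- other than 1, while Haar measure is invariant.
open MeasureTheory in
lemma integral_torusPow_eq_zero [MeasurableSpace (Fin k → Circle)] [BorelSpace (Fin k → Circle)]
    (μ : Measure (Fin k → Circle)) [μ.IsHaarMeasure] {m n : Fin k → ℕ} (h : m ≠ n) :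
    ∫ z : Fin k → Circle, ((torusPow z m / torusPow z n : Circle) : ℂ) ∂μ = 0 := by
  obtain ⟨w, hw⟩ := exists_torusPow_ne h
  have e := integral_mul_left_eq_self (μ := μ)
    (fun z : Fin k → Circle => ((torusPow z m / torusPow z n : Circle) : ℂ)) w
  simp only [mul_torusPow, mul_div_mul_comm, Circle.coe_mul] at e
  rw [integral_const_mul] at e
  by_contra h0
  have e2 : ((torusPow w m / torusPow w n : Circle) : ℂ) = 1 := (mul_eq_right₀ h0).1 e
  exact hw (div_eq_one.1 (Circle.coe_eq_one.1 e2))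

variable {Λ : KGraph.{u} k} [Λ.FinitelyAligned]

lemma IsCuntzKriegerFamily.mul_mem_span {A : Type*} [NonUnitalCStarAlgebra A]
    {t : ∀ ⦃v w : Λ.Vertex⦄, (v ⟶ w) → A} (ht : Λ.IsCuntzKriegerFamily t) {M : Submodule ℂ A}
    (hM : M = Submodule.span ℂ (Set.range fun r : Λ.Path × Λ.Path => r.1.val t * star (r.2.val t)))
    {x y : A} (hx : x ∈ M) (hy : y ∈ M) : x * y ∈ M := by
  have hM' (r : Λ.Path × Λ.Path) : r.1.val t * star (r.2.val t) ∈ M :=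
    hM ▸ Submodule.subset_span ⟨r, rfl⟩
  rw [hM] at hx hy
  refine (Submodule.span_le (p := M.comap (LinearMap.mulRight ℂ y))).2 ?_ hx
  rintro _ ⟨⟨p, q⟩, rfl⟩
  refine (Submodule.span_le (p := M.comap (LinearMap.mulLeft ℂ (p.val t * star (q.val t))))).2 ?_ hy
  rintro _ ⟨⟨r, s⟩, rfl⟩
  change p.val t * star (q.val t) * (r.val t * star (s.val t)) ∈ M
  by_cases h1 : p.1 = q.1
  swap
  · rw [ht.mul_star_of_source_ne h1, zero_mul]; exact zero_mem _
  by_cases h2 : r.1 = s.1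
  swap
  · rw [ht.mul_star_of_source_ne h2, mul_zero]; exact zero_mem _
  obtain ⟨a, v, f⟩ := p
  obtain ⟨a', v', g⟩ := q
  obtain ⟨b, w, h⟩ := r
  obtain ⟨b', w', l⟩ := s
  dsimp only at h1 h2
  subst h1 h2
  have e : (t f * star (t g)) * (t h * star (t l)) = t f * (star (t g) * t h) * star (t l) := by
    simp only [mul_assoc]
  simp only [Path.val, e]
  by_cases h3 : v' = w
  swap
  · rw [ht.adjoint_mul_of_ne g h h3]; simp
  subst h3
  rw [ht.adjoint_mul, Finset.mul_sum, Finset.sum_mul]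
  refine Submodule.sum_mem _ fun x _ => ?_
  rw [ht.sandwich]
  exact hM' (⟨_, _, x.2.1 ≫ f⟩, ⟨_, _, x.2.2 ≫ l⟩)

/-- `C^*(Λ)` is the closed span of the elements `s_p s_q^*`. -/
lemma closure_span_eq_univ :
    closure (Submodule.span ℂ (Set.range fun r : Λ.Path × Λ.Path =>
      r.1.val Λ.s * star (r.2.val Λ.s)) : Set Λ.CStar) = Set.univ := by
  let C : NonUnitalStarSubalgebra ℂ Λ.CStar :=
    { Submodule.span ℂ (Set.range fun r : Λ.Path × Λ.Path => r.1.val Λ.s * star (r.2.val Λ.s)) with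
      mul_mem' := fun hx hy => Λ.isCuntzKriegerFamily_s.mul_mem_span rfl hx hy
      star_mem' := fun {x} hx => by
        change x ∈ Submodule.span _ _ at hx
        change star x ∈ Submodule.span _ _
        induction hx using Submodule.span_induction with
        | mem y hy =>
          obtain ⟨r, rfl⟩ := hy
          exact Submodule.subset_span ⟨(r.2, r.1), by simp⟩
        | zero => simp
        | add y z _ _ hy hz => rw [star_add]; exact add_mem hy hz
        | smul c y _ hy => rw [star_smul]; exact Submodule.smul_mem _ _ hy }
  have hle : generatedCStar (familyRange Λ.s) ≤ C.topologicalClosure := by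
    refine generatedCStar_le C.isClosed_topologicalClosure ?_
    rintro _ ⟨p, rfl⟩
    refine C.le_topologicalClosure (Submodule.subset_span ⟨(p, ⟨p.1, p.1, 𝟙 _⟩), ?_⟩)
    simp only [Path.val]
    rw [Λ.isCuntzKriegerFamily_s.star_id, Λ.isCuntzKriegerFamily_s.mul_id]
  rw [generatedCStar_s] at hle
  exact Set.eq_univ_of_univ_subset fun x _ => hle (Set.mem_univ x)

lemma norm_gaugeHom_le (z : Fin k → Circle) (a : Λ.CStar) : ‖Λ.gaugeHom z a‖ ≤ ‖a‖ :=
  NonUnitalStarAlgHom.norm_apply_le _ _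

/-- The gauge action is strongly continuous. -/
lemma continuous_gaugeHom (a : Λ.CStar) : Continuous fun z => Λ.gaugeHom z a := by
  let C : NonUnitalStarSubalgebra ℂ Λ.CStar :=
    { carrier := {a | Continuous fun z => Λ.gaugeHom z a}
      add_mem' := fun {a b} ha hb => by
        simp only [Set.mem_ofPred_eq, map_add] at ha hb ⊢
        exact ha.add hb
      mul_mem' := fun {a b} ha hb => by
        simp only [Set.mem_ofPred_eq, map_mul] at ha hb ⊢
        exact ha.mul hb
      zero_mem' := by simpa only [Set.mem_ofPred_eq, map_zero] using continuous_const
      smul_mem' := fun c {a} ha => by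
        simp only [Set.mem_ofPred_eq, map_smul] at ha ⊢
        exact ha.const_smul c
      star_mem' := fun {a} ha => by simpa only [Set.mem_ofPred_eq, map_star] using ha.star }
  have hC : IsClosed (C : Set Λ.CStar) := by
    refine isClosed_of_closure_subset fun a ha => ?_
    refine continuous_of_uniform_approx_of_continuous (fun u hu => ?_)
    obtain ⟨ε, hε, hu⟩ := Metric.mem_uniformity_dist.1 hu
    obtain ⟨b, hb, hab⟩ := Metric.mem_closure_iff.1 ha ε hε
    refine ⟨fun z => Λ.gaugeHom z b, hb, fun z => hu ?_⟩
    -- Each γ_z is contractive, so approximating the element approximates its orbit map uniformly in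
    -- z.
    rw [dist_eq_norm, ← map_sub]
    exact (norm_gaugeHom_le z _).trans_lt (by rwa [← dist_eq_norm])
  have hle : generatedCStar (familyRange Λ.s) ≤ C := by
    refine generatedCStar_le hC ?_
    rintro _ ⟨p, rfl⟩
    change Continuous fun z => Λ.gaugeHom z (Λ.s p.2.2)
    simp only [gaugeHom_s]
    exact (continuous_subtype_val.comp (continuous_torusPow _)).smul continuous_const
  rw [generatedCStar_s] at hle
  exact hle (Set.mem_univ a)

lemma gaugeHom_mul_star (z : Fin k → Circle) (p q : Λ.Path) :
    Λ.gaugeHom z (p.val Λ.s * star (q.val Λ.s)) =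
      ((torusPow z p.deg / torusPow z q.deg : Circle) : ℂ) • (p.val Λ.s * star (q.val Λ.s)) := by
  rw [map_mul, map_star, Path.val, Path.val, gaugeHom_s, gaugeHom_s, star_smul, smul_mul_smul_comm,
    div_eq_mul_inv, Circle.coe_mul, Circle.coe_inv_eq_conj]
  rfl

open MeasureTheory in
/-- Averaging over the gauge action maps `C^*(Λ)` into the closure of the core. -/
lemma integral_gaugeHom_mem_closure_core [MeasurableSpace (Fin k → Circle)]
    [BorelSpace (Fin k → Circle)] (μ : Measure (Fin k → Circle)) [μ.IsHaarMeasure] (a : Λ.CStar) :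
    ∫ z, Λ.gaugeHom z a ∂μ ∈ closure (core Λ.s Set.univ : Set Λ.CStar) := by
  have hi (a : Λ.CStar) : Integrable (fun z => Λ.gaugeHom z a) μ :=
    (continuous_gaugeHom a).integrable_of_hasCompactSupport (.of_compactSpace _)
  let Φ : Λ.CStar →ₗ[ℂ] Λ.CStar :=
    { toFun := fun a => ∫ z, Λ.gaugeHom z a ∂μ
      map_add' := fun a b => by
        simp only [map_add]
        exact integral_add (hi a) (hi b)
      map_smul' := fun c a => by
        simp only [map_smul]
        exact integral_smul c _ }
  have hΦ : Continuous Φ := (Φ.mkContinuous (μ.real Set.univ) fun a => by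
    rw [mul_comm]
    exact norm_integral_le_of_norm_le_const (.of_forall fun z => norm_gaugeHom_le z a)).continuous
  have hsub : Submodule.span ℂ (Set.range fun r : Λ.Path × Λ.Path =>
      r.1.val Λ.s * star (r.2.val Λ.s)) ≤ (core Λ.s Set.univ).comap Φ := by
    refine Submodule.span_le.2 ?_
    rintro _ ⟨⟨p, q⟩, rfl⟩
    change ∫ z, Λ.gaugeHom z (p.val Λ.s * star (q.val Λ.s)) ∂μ ∈ core Λ.s Set.univ
    simp only [gaugeHom_mul_star]
    rw [integral_smul_const]
    -- The average keeps multiples of the terms of equal degree and annihilates the others.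
    by_cases h : p.deg = q.deg
    · exact Submodule.smul_mem _ _ (Submodule.subset_span
        (Set.mem_iUnion₂_of_mem (Set.mem_univ p.deg) ⟨p, q, rfl, h.symm, rfl⟩))
    · rw [integral_torusPow_eq_zero μ h, zero_smul]
      exact zero_mem _
  have ha : a ∈ closure _ := (closure_span_eq_univ (Λ := Λ)).symm ▸ Set.mem_univ a
  exact map_mem_closure (f := Φ) hΦ ha fun x hx => hsub hx

end KGraph

/-! ### The gauge-invariant uniqueness theorem. -/

theorem theorem4p2 {k : ℕ} (Λ : KGraph.{u} k) [Λ.FinitelyAligned]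
    {B : Type w} [NonUnitalCStarAlgebra B] (π : Λ.CStar →⋆ₙₐ[ℂ] B)
    (θ : (Fin k → Circle) →*
      (KGraph.generatedCStar (KGraph.familyRange fun _ _ f => π (Λ.s f)) ≃⋆ₐ[ℂ]
        KGraph.generatedCStar (KGraph.familyRange fun _ _ f => π (Λ.s f))))
    (hθ_cont : ∀ b, Continuous fun z => θ z b)
    (hθ : ∀ z a, (θ z ⟨π a, KGraph.apply_mem_generatedCStar π a⟩ : B) = π (Λ.gauge z a))
    (hπ : ∀ v : Λ.Vertex, π (Λ.s (𝟙 v)) ≠ 0) :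
    Function.Injective π := by
  refine (injective_iff_map_eq_zero π).2 fun a ha => ?_
  -- Equivariance makes the kernel of π gauge invariant.
  have hker (z : Fin k → Circle) : π (Λ.gaugeHom z a) = 0 := by
    have h0 : (⟨π a, KGraph.apply_mem_generatedCStar π a⟩ :
        KGraph.generatedCStar (KGraph.familyRange fun _ _ f => π (Λ.s f))) = 0 := Subtype.ext ha
    have := hθ z a
    rw [h0, map_zero] at this
    exact this.symm
  let _ : MeasurableSpace (Fin k → Circle) := borel _
  have : BorelSpace (Fin k → Circle) := ⟨rfl⟩
  let μ : MeasureTheory.Measure (Fin k → Circle) := MeasureTheory.Measure.haar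
  have hi : MeasureTheory.Integrable (fun z => Λ.gaugeHom z (star a * a)) μ :=
    (KGraph.continuous_gaugeHom _).integrable_of_hasCompactSupport (.of_compactSpace _)
  have h1 : π (∫ z, Λ.gaugeHom z (star a * a) ∂μ) = 0 := by
    let L : Λ.CStar →L[ℂ] B := ⟨(π : Λ.CStar →ₗ[ℂ] B), map_continuous π⟩
    have := L.integral_comp_comm hi
    change _ = π _ at this
    rw [← this]
    have h2 (z) : L (Λ.gaugeHom z (star a * a)) = 0 := by
      change π (Λ.gaugeHom z (star a * a)) = 0
      rw [map_mul, map_mul, hker, mul_zero]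
    simp only [h2, MeasureTheory.integral_zero]
  have h2 := Λ.isCuntzKriegerFamily_s.norm_map_of_mem_closure_core π hπ
    (KGraph.integral_gaugeHom_mem_closure_core μ (star a * a))
  rw [h1, norm_zero, eq_comm, norm_eq_zero] at h2
  simp only [map_mul, map_star] at h2 hi
  -- The average of γ_z(a)^* γ_z(a) is zero, so γ_z(a) vanishes at every z; z = 1 recovers a.
  have := eq_zero_of_integral_star_mul_self_eq_zero (KGraph.continuous_gaugeHom a) hi h2 1
  rwa [KGraph.gaugeHom_one] at this
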